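/- **Theorem 6 (Reality Conditions for Bounded Two-Phase Solutions).** *Setting.* Let $p:\mathbb{R}^2\to\mathbb{C}$ be a smooth bounded solution of the focusing nonlinear Schrödinger equation $i p_t+p_{xx}+2|p|^2p=0$, and write $'=\partial_x$, $\nu_1=|p|^2$, $\nu_2=i(p^*p'-pp^{*\prime})$. Let $$\mathbb{U}=\begin{pmatrix}-i\lambda & ip\\ ip^* & i\lambda\end{pmatrix},\qquad \mathbb{V}=\begin{pmatrix}-2i\lambda^2+i|p|^2 & 2i\lambda p-p_x\\ 2i\lambda p^*+p^*_x & 2i\lambda^2-i|p|^2\end{pmatrix}$$ and, for real constants $c_0,c_1,c_2$, let $\Psi=\begin{pmatrix}\Psi_{11}&\Psi_{12}\\ \Psi_{21}&-\Psi_{11}\end{pmatrix}$ with $$\Psi_{11}=-i\lambda^3-ic_2\lambda^2+(\tfrac12 i|p|^2-ic_1)\lambda+\tfrac14(pp^{*\prime}-p'p^*)+\tfrac12 ic_2|p|^2-ic_0,$$ $$\Psi_{12}=ip\lambda^2+(-\tfrac12p'+ic_2p)\lambda-\tfrac14ip''-\tfrac12ip|p|^2-\tfrac12c_2p'+ic_1p,$$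 $$\Psi_{21}=ip^*\lambda^2+(\tfrac12p^{*\prime}+ic_2p^*)\lambda-\tfrac14ip^{*\prime\prime}-\tfrac12ip^*|p|^2+\tfrac12c_2p^{*\prime}+ic_1p^*.$$ Assume that $p$ is a two-phase solution with constants $c_0,c_1,c_2$: $\Psi_x=[\mathbb{U},\Psi]$ and $\Psi_t=[\mathbb{V},\Psi]$ for all $\lambda\in\mathbb{C}$. The branch points $\lambda_1,\dots,\lambda_6$ are the roots of $\mathscr{R}(\lambda)=-\Psi_{11}^2-\Psi_{12}\Psi_{21}=\prod_{i=1}^6(\lambda-\lambda_i)$, which does not depend on $(x,t)$. Assume that the curve $w^2=\mathscr{R}(\lambda)$ is non-singular, i.e. that the six branch points are distinct. *The polynomial $P$.* Let $\Lambda_k$ be the elementary symmetric functions of the branch points. As polynomials in two independent variables $\nu_1,\nu_2$ (also denoted so), put $S_k=\nu_1\Sigma_k$, where $$S_1=-\tfrac12\nu_2+\Lambda_1\nu_1,$$ $$S_2=-\tfrac14\Lambda_1\nu_2-\tfrac14\nu_1^2+\left(-\tfrac5{64}\Lambda_1^4+\tfrac38\Lambda_1^2\Lambda_2-\tfrac14\Lambda_2^2-\tfrac12\Lambda_1\Lambda_3+\Lambda_4\right)+\left(\tfrac12\Lambda_2+\tfrac18\Lambda_1^2\right)\nu_1,$$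 $$S_3=\tfrac14\nu_1\nu_2+\left(\tfrac1{16}\Lambda_1^2-\tfrac14\Lambda_2\right)\nu_2-\tfrac14\Lambda_1\nu_1^2+\left(\tfrac1{64}\Lambda_1^5-\tfrac18\Lambda_1^3\Lambda_2+\tfrac18\Lambda_1^2\Lambda_3+\tfrac14\Lambda_1\Lambda_2^2-\tfrac12\Lambda_2\Lambda_3+\Lambda_5\right)+\tfrac12\Lambda_3\nu_1,$$ $$\begin{aligned}S_4={}&\tfrac18\Lambda_1\nu_1\nu_2-\tfrac1{16}\nu_2^2-\tfrac1{16}\Lambda_1^2\nu_1^2+\left(-\tfrac1{32}\Lambda_1^3+\tfrac18\Lambda_1\Lambda_2-\tfrac14\Lambda_3\right)\nu_2\\&+\left(-\tfrac1{256}\Lambda_1^6+\tfrac1{32}\Lambda_1^4\Lambda_2-\tfrac1{16}\Lambda_1^3\Lambda_3-\tfrac1{16}\Lambda_1^2\Lambda_2^2+\tfrac14\Lambda_1\Lambda_2\Lambda_3-\tfrac14\Lambda_3^2+\Lambda_6\right)\\&+\left(\tfrac1{32}\Lambda_1^4-\tfrac18\Lambda_1^2\Lambda_2+\tfrac14\Lambda_1\Lambda_3\right)\nu_1,\end{aligned}$$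 (where $p\ne0$, $\Sigma_1,\dots,\Sigma_4$ are the elementary symmetric functions of the two roots $\mu_1,\mu_2$ of $\Psi_{12}$ and their conjugates) and let $\hat\Sigma_2=-\tfrac38\Sigma_1^2+\Sigma_2$, $\hat\Sigma_3=\tfrac18\Sigma_1^3-\tfrac12\Sigma_1\Sigma_2+\Sigma_3$, $\hat\Sigma_4=-\tfrac3{256}\Sigma_1^4+\tfrac1{16}\Sigma_1^2\Sigma_2-\tfrac14\Sigma_1\Sigma_3+\Sigma_4$. Then $P(\nu_1)$ is the polynomial obtained by eliminating $\nu_2$ from $\hat\Sigma_3=0$ and $\hat\Sigma_2^2-4\hat\Sigma_4=0$: the quotient by $\nu_1^8$ of the resultant with respect to $\nu_2$ of $\nu_1^3\hat\Sigma_3$ and $\nu_1^4(\hat\Sigma_2^2-4\hat\Sigma_4)$. A value of $\nu_2$ *corresponds* to a value of $\nu_1$ if, for some permutation $\pi\in S_6$, $\nu_1=-\tfrac14\chi_1^2$ and $\nu_2=-\tfrac12\chi_1\chi_2$, where $\chi_j=\lambda_{\pi(1)}^j+\lambda_{\pi(2)}^j+\lambda_{\pi(3)}^j-\lambda_{\pi(4)}^j-\lambda_{\pi(5)}^j-\lambda_{\pi(6)}^j$.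 *Conclusion.* The branch points form three complex-conjugate pairs $r_k\pm is_k$, $k=1,2,3$, with $r_k,s_k\in\mathbb{R}$, and they can be numbered so that $0<s_1\le s_2\le s_3$. The polynomial $P$ has degree ten. For every such numbering, put $$\nu_1^{(1)}=(s_1+s_2-s_3)^2,\quad \nu_1^{(2)}=(s_1-s_2+s_3)^2,\quad \nu_1^{(3)}=(-s_1+s_2+s_3)^2,\quad \nu_1^{(4)}=(s_1+s_2+s_3)^2,$$ $$\begin{aligned}\nu_2^{(1)}&=4(s_1+s_2-s_3)(r_1s_1+r_2s_2-r_3s_3),&\nu_2^{(2)}&=4(s_1-s_2+s_3)(r_1s_1-r_2s_2+r_3s_3),\\ \nu_2^{(3)}&=4(-s_1+s_2+s_3)(-r_1s_1+r_2s_2+r_3s_3),&\nu_2^{(4)}&=4(s_1+s_2+s_3)(r_1s_1+r_2s_2+r_3s_3).\end{aligned}$$ 1. There are exactly four distinct real pairs $(\nu_1,\nu_2)$ in which $P(\nu_1)=0$ and $\nu_2$ corresponds to $\nu_1$, namely $(\nu_1^{(i)},\nu_2^{(i)})$, $i=1,\dots,4$. 2. $0\le\nu_1^{(1)}\le\nu_1^{(2)}\le\nu_1^{(3)}<\nu_1^{(4)}$,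 where the second inequality is strict if $s_2<s_3$ and the third is strict if $s_1<s_2$; so the four values are distinct if $s_1,s_2,s_3$ are. 3. If $r_1,r_2,r_3$ are distinct, then $\nu_1^{(1)},\dots,\nu_1^{(4)}$ are the only real roots of $P$, and every value of $\nu_2$ corresponding to a real $\nu_1$ is real. 4. The $\nu_1^{(i)}$ are the only possible non-zero bounds of the solution: at every local extremum of $|p|^2$ with non-zero value, $(\nu_1,\nu_2)=(\nu_1^{(i)},\nu_2^{(i)})$ for some $i$; and the supremum and the infimum of $|p|^2$ over $\mathbb{R}^2$, if not zero, are among the $\nu_1^{(i)}$. -/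

import Mathlib

open scoped ContDiff

/-! ## The focusing NLS equation and its Lax pair -/

/-- Partial derivative in `x` of a function of `(x, t)`. -/
noncomputable def dx (f : ℝ → ℝ → ℂ) (x t : ℝ) : ℂ := deriv (fun y => f y t) x

/-- Partial derivative in `t` of a function of `(x, t)`. -/
noncomputable def dt (f : ℝ → ℝ → ℂ) (x t : ℝ) : ℂ := deriv (fun u => f x u) t

/-- The focusing nonlinear Schrödinger equation `i p_t + p_xx + 2 |p|^2 p = 0` on `ℝ²`. -/
def SolvesNLS (p : ℝ → ℝ → ℂ) : Prop :=
  ∀ x t : ℝ, Complex.I * dt p x t + dx (dx p) x t + 2 * (‖p x t‖ : ℂ) ^ 2 * p x t = 0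

/-- The matrix `𝕌` of the Lax pair. -/
noncomputable def laxU (p : ℝ → ℝ → ℂ) (l : ℂ) (x t : ℝ) : Matrix (Fin 2) (Fin 2) ℂ :=
  !![-Complex.I * l, Complex.I * p x t;
     Complex.I * star (p x t), Complex.I * l]

/-- The matrix `𝕍` of the Lax pair. -/
noncomputable def laxV (p : ℝ → ℝ → ℂ) (l : ℂ) (x t : ℝ) : Matrix (Fin 2) (Fin 2) ℂ :=
  !![-2 * Complex.I * l ^ 2 + Complex.I * (‖p x t‖ : ℂ) ^ 2,
      2 * Complex.I * l * p x t - dx p x t;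
     2 * Complex.I * l * star (p x t) + star (dx p x t),
      2 * Complex.I * l ^ 2 - Complex.I * (‖p x t‖ : ℂ) ^ 2]

/-! ## Two-phase solutions -/

/-- The entry `Ψ₁₁`, a cubic polynomial in the spectral parameter `l`;
`c 0, c 1, c 2` are the real constants of integration. -/
noncomputable def psi11 (p : ℝ → ℝ → ℂ) (c : Fin 3 → ℝ) (l : ℂ) (x t : ℝ) : ℂ :=
  -Complex.I * l ^ 3 - Complex.I * c 2 * l ^ 2
    + (1 / 2 * Complex.I * (‖p x t‖ : ℂ) ^ 2 - Complex.I * c 1) * l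
    + 1 / 4 * (p x t * star (dx p x t) - dx p x t * star (p x t))
    + 1 / 2 * Complex.I * c 2 * (‖p x t‖ : ℂ) ^ 2 - Complex.I * c 0

/-- The entry `Ψ₁₂`. -/
noncomputable def psi12 (p : ℝ → ℝ → ℂ) (c : Fin 3 → ℝ) (l : ℂ) (x t : ℝ) : ℂ :=
  Complex.I * p x t * l ^ 2
    + (-(1 / 2) * dx p x t + Complex.I * c 2 * p x t) * l
    - 1 / 4 * Complex.I * dx (dx p) x t
    - 1 / 2 * Complex.I * p x t * (‖p x t‖ : ℂ) ^ 2
    - 1 / 2 * c 2 * dx p x t + Complex.I * c 1 * p x t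

/-- The entry `Ψ₂₁`. -/
noncomputable def psi21 (p : ℝ → ℝ → ℂ) (c : Fin 3 → ℝ) (l : ℂ) (x t : ℝ) : ℂ :=
  Complex.I * star (p x t) * l ^ 2
    + (1 / 2 * star (dx p x t) + Complex.I * c 2 * star (p x t)) * l
    - 1 / 4 * Complex.I * star (dx (dx p) x t)
    - 1 / 2 * Complex.I * star (p x t) * (‖p x t‖ : ℂ) ^ 2
    + 1 / 2 * c 2 * star (dx p x t) + Complex.I * c 1 * star (p x t)

/-- The traceless matrix `Ψ`, a polynomial of degree three in `l`. -/
noncomputable def psi (p : ℝ → ℝ → ℂ) (c : Fin 3 → ℝ) (l : ℂ) (x t : ℝ) :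
    Matrix (Fin 2) (Fin 2) ℂ :=
  !![psi11 p c l x t, psi12 p c l x t;
     psi21 p c l x t, -psi11 p c l x t]

/-- `p` is a smooth two-phase solution of the focusing NLS equation, with constants of integration
`c 0, c 1, c 2`: it is smooth on `ℝ²`, solves the NLS equation, and the cubic matrix polynomial `Ψ`
satisfies `Ψ_x = [𝕌, Ψ]` and `Ψ_t = [𝕍, Ψ]` for every value of the spectral parameter. -/
structure IsSmoothTwoPhaseSolution (p : ℝ → ℝ → ℂ) (c : Fin 3 → ℝ) : Prop where
  smooth : ContDiff ℝ ∞ (fun q : ℝ × ℝ => p q.1 q.2)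
  nls : SolvesNLS p
  stationary_x : ∀ (l : ℂ) (x t : ℝ) (i j : Fin 2),
    HasDerivAt (fun y => psi p c l y t i j)
      ((laxU p l x t * psi p c l x t - psi p c l x t * laxU p l x t) i j) x
  stationary_t : ∀ (l : ℂ) (x t : ℝ) (i j : Fin 2),
    HasDerivAt (fun u => psi p c l x u i j)
      ((laxV p l x t * psi p c l x t - psi p c l x t * laxV p l x t) i j) t

/-- `p` is bounded on `ℝ²`. -/
def IsBoundedSolution (p : ℝ → ℝ → ℂ) : Prop := ∃ B : ℝ, ∀ x t : ℝ, ‖p x t‖ ≤ B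

/-- `ν₁ = |p|²`. -/
noncomputable def nu1 (p : ℝ → ℝ → ℂ) (x t : ℝ) : ℝ := ‖p x t‖ ^ 2

/-- `ν₂ = i (p* p' - p p*')`. -/
noncomputable def nu2 (p : ℝ → ℝ → ℂ) (x t : ℝ) : ℂ :=
  Complex.I * (star (p x t) * dx p x t - p x t * star (dx p x t))

/-- `lam 0, …, lam 5` are the branch points (with multiplicity) of the invariant spectral curve
`det (i w - Ψ(l)) = -w² + 𝓡(l) = 0`, that is `𝓡(l) = -Ψ₁₁² - Ψ₁₂ Ψ₂₁ = ∏ (l - lam i)`. The left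
side does not depend on `(x, t)`, so it is only read off at one point. -/
def IsBranchPoints (p : ℝ → ℝ → ℂ) (c : Fin 3 → ℝ) (lam : Fin 6 → ℂ) : Prop :=
  ∃ x t : ℝ, ∀ l : ℂ,
    -psi11 p c l x t ^ 2 - psi12 p c l x t * psi21 p c l x t = ∏ i, (l - lam i)

/-! ## The polynomial `P`

`Σ₁, …, Σ₄` are the elementary symmetric functions of the Dirichlet eigenvalues
`μ₁, μ₂, μ₁*, μ₂*`; they are rational functions of `(ν₁, ν₂)` with coefficients depending on the
elementary symmetric functions `Λ₁, …, Λ₆` of the branch points. The polynomial `P` in `ν₁` is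
obtained by eliminating `ν₂` from `Σ̂₃ = 0` and `Σ̂₂² - 4 Σ̂₄ = 0`, where `Σ̂ₖ` are the
coefficients of the quartic with roots `μ₁, μ₂, μ₁*, μ₂*` after removal of its cubic term.

Polynomials in `(ν₁, ν₂)` are elements of `Polynomial (Polynomial ℂ)`: the inner variable is `ν₁`,
the outer variable is `ν₂`. -/

namespace Elim

open Polynomial

/-- `Λ k`, the elementary symmetric function of degree `k` of the branch points. -/
noncomputable def Lam (lam : Fin 6 → ℂ) (k : ℕ) : ℂ :=
  (Multiset.map lam Finset.univ.val).esymm k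

/-- A complex constant, as a polynomial in `(ν₁, ν₂)`. -/
noncomputable def k (z : ℂ) : ℂ[X][X] := C (C z)

/-- The variable `ν₁`. -/
noncomputable def n1 : ℂ[X][X] := C X

/-- The variable `ν₂`. -/
noncomputable def n2 : ℂ[X][X] := X

/-- `ν₁ Σ₁`, where `Σ₁ = -ν₂ / (2 ν₁) + Λ₁`. -/
noncomputable def S1 (L : ℕ → ℂ) : ℂ[X][X] :=
  k (-1 / 2) * n2 + k (L 1) * n1

/-- `ν₁ Σ₂`. -/
noncomputable def S2 (L : ℕ → ℂ) : ℂ[X][X] :=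
  k (-1 / 4 * L 1) * n2 - k (1 / 4) * n1 ^ 2
    + k (-5 / 64 * L 1 ^ 4 + 3 / 8 * L 1 ^ 2 * L 2 - 1 / 4 * L 2 ^ 2 - 1 / 2 * L 1 * L 3 + L 4)
    + k (1 / 2 * L 2 + 1 / 8 * L 1 ^ 2) * n1

/-- `ν₁ Σ₃`. -/
noncomputable def S3 (L : ℕ → ℂ) : ℂ[X][X] :=
  k (1 / 4) * n1 * n2 + k (1 / 16 * L 1 ^ 2 - 1 / 4 * L 2) * n2 - k (1 / 4 * L 1) * n1 ^ 2
    + k (1 / 64 * L 1 ^ 5 - 1 / 8 * L 1 ^ 3 * L 2 + 1 / 8 * L 1 ^ 2 * L 3 + 1 / 4 * L 1 * L 2 ^ 2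
        - 1 / 2 * L 2 * L 3 + L 5)
    + k (1 / 2 * L 3) * n1

/-- `ν₁ Σ₄`. -/
noncomputable def S4 (L : ℕ → ℂ) : ℂ[X][X] :=
  k (1 / 8 * L 1) * n1 * n2 - k (1 / 16) * n2 ^ 2 - k (1 / 16 * L 1 ^ 2) * n1 ^ 2
    + k (-1 / 32 * L 1 ^ 3 + 1 / 8 * L 1 * L 2 - 1 / 4 * L 3) * n2
    + k (-1 / 256 * L 1 ^ 6 + 1 / 32 * L 1 ^ 4 * L 2 - 1 / 16 * L 1 ^ 3 * L 3
        - 1 / 16 * L 1 ^ 2 * L 2 ^ 2 + 1 / 4 * L 1 * L 2 * L 3 - 1 / 4 * L 3 ^ 2 + L 6)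
    + k (1 / 32 * L 1 ^ 4 - 1 / 8 * L 1 ^ 2 * L 2 + 1 / 4 * L 1 * L 3) * n1

/-- `ν₁² Σ̂₂`, where `Σ̂₂ = -3/8 Σ₁² + Σ₂`. -/
noncomputable def H2 (L : ℕ → ℂ) : ℂ[X][X] :=
  -k (3 / 8) * S1 L ^ 2 + n1 * S2 L

/-- `ν₁³ Σ̂₃`, where `Σ̂₃ = 1/8 Σ₁³ - 1/2 Σ₁ Σ₂ + Σ₃`. -/
noncomputable def H3 (L : ℕ → ℂ) : ℂ[X][X] :=
  k (1 / 8) * S1 L ^ 3 - k (1 / 2) * n1 * S1 L * S2 L + n1 ^ 2 * S3 L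

/-- `ν₁⁴ Σ̂₄`, where `Σ̂₄ = -3/256 Σ₁⁴ + 1/16 Σ₁² Σ₂ - 1/4 Σ₁ Σ₃ + Σ₄`. -/
noncomputable def H4 (L : ℕ → ℂ) : ℂ[X][X] :=
  -k (3 / 256) * S1 L ^ 4 + k (1 / 16) * n1 * S1 L ^ 2 * S2 L
    - k (1 / 4) * n1 ^ 2 * S1 L * S3 L + n1 ^ 3 * S4 L

/-- The resultant with respect to `ν₂` of `ν₁³ Σ̂₃` (degree `3` in `ν₂`) and
`ν₁⁴ (Σ̂₂² - 4 Σ̂₄)` (degree `4` in `ν₂`). It is a polynomial in `ν₁`. -/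
noncomputable def elimNu2 (L : ℕ → ℂ) : ℂ[X] :=
  resultant (H3 L) (H2 L ^ 2 - 4 * H4 L) 3 4

end Elim

/-- The polynomial `P(ν₁)`: the result of the elimination of `ν₂`, without the factor `ν₁⁸`, which
is always present and comes only from clearing the denominators. -/
noncomputable def polyP (lam : Fin 6 → ℂ) : Polynomial ℂ :=
  Elim.elimNu2 (Elim.Lam lam) /ₘ (Polynomial.X ^ 8)

/-! ## The roots in terms of the branch points -/

/-- `χ₁`, for the arrangement `π` of the branch points. -/
def chi1 (lam : Fin 6 → ℂ) (π : Equiv.Perm (Fin 6)) : ℂ :=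
  lam (π 0) + lam (π 1) + lam (π 2) - lam (π 3) - lam (π 4) - lam (π 5)

/-- `χ₂`, for the arrangement `π` of the branch points. -/
def chi2 (lam : Fin 6 → ℂ) (π : Equiv.Perm (Fin 6)) : ℂ :=
  lam (π 0) ^ 2 + lam (π 1) ^ 2 + lam (π 2) ^ 2
    - lam (π 3) ^ 2 - lam (π 4) ^ 2 - lam (π 5) ^ 2

/-- `z₂` is a value of `ν₂` corresponding to the value `z₁` of `ν₁`: both come from one arrangement
of the branch points through `ν₁ = -χ₁² / 4` and `ν₂ = -χ₁ χ₂ / 2`. -/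
def Corresponds (lam : Fin 6 → ℂ) (z₁ z₂ : ℂ) : Prop :=
  ∃ π : Equiv.Perm (Fin 6),
    z₁ = -(1 / 4) * chi1 lam π ^ 2 ∧ z₂ = -(1 / 2) * chi1 lam π * chi2 lam π

/-- The six branch points are, in some order, the three complex-conjugate pairs `r k ± i s k`, with
`0 < s 0 ≤ s 1 ≤ s 2`. -/
def AreConjugatePairs (lam : Fin 6 → ℂ) (r s : Fin 3 → ℝ) : Prop :=
  0 < s 0 ∧ s 0 ≤ s 1 ∧ s 1 ≤ s 2 ∧
  ∃ π : Equiv.Perm (Fin 6),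
    lam (π 0) = r 0 + Complex.I * s 0 ∧ lam (π 1) = r 0 - Complex.I * s 0 ∧
    lam (π 2) = r 1 + Complex.I * s 1 ∧ lam (π 3) = r 1 - Complex.I * s 1 ∧
    lam (π 4) = r 2 + Complex.I * s 2 ∧ lam (π 5) = r 2 - Complex.I * s 2

/-- The four values `ν₁⁽¹⁾, …, ν₁⁽⁴⁾`. -/
def nu1Root (s : Fin 3 → ℝ) : Fin 4 → ℝ :=
  ![(s 0 + s 1 - s 2) ^ 2, (s 0 - s 1 + s 2) ^ 2, (-s 0 + s 1 + s 2) ^ 2, (s 0 + s 1 + s 2) ^ 2]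

/-- The four values `ν₂⁽¹⁾, …, ν₂⁽⁴⁾`. -/
def nu2Root (r s : Fin 3 → ℝ) : Fin 4 → ℝ :=
  ![4 * (s 0 + s 1 - s 2) * (r 0 * s 0 + r 1 * s 1 - r 2 * s 2),
    4 * (s 0 - s 1 + s 2) * (r 0 * s 0 - r 1 * s 1 + r 2 * s 2),
    4 * (-s 0 + s 1 + s 2) * (-(r 0 * s 0) + r 1 * s 1 + r 2 * s 2),
    4 * (s 0 + s 1 + s 2) * (r 0 * s 0 + r 1 * s 1 + r 2 * s 2)]

/-! Write 𝓡 = A² + Q, where A is the monic cubic iΨ₁₁ and Q = -Ψ₁₂Ψ₂₁ = ν₁l⁴ - S₁l³ + S₂l² - S₃l +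
S₄. The equations Σ̂₃ = 0 and Σ̂₂² = 4Σ̂₄ say that the depressed quartic Q/ν₁ is a perfect square.
Then 𝓡 = A² + (nq)² with n² = ν₁, and the monic cubics A ± inq divide the six branch points into two
triples; comparing power sums gives ν₁ = -χ₁²/4 and ν₂ = -χ₁χ₂/2 (`corresponds_of_sq_add_sq`).
Conversely, two triples with monic cubics F, G give 𝓡 = ((F + G)/2)² - ((F - G)/2)². Hence the roots
of P are the values -χ₁²/4 (`isRoot_polyP_iff_exists_corresponds`). The value 0 needs its own
argument, since the quartic degenerates there. The degree of P is read off from an explicit form of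
the resultant (`closedForm`).

On the real axis 𝓡 = |Ψ₁₁|² + |Ψ₁₂|², so a real zero would be a zero of every entry of Ψ and thus a
double zero. The simple branch points therefore form conjugate pairs. An arrangement that separates
every pair has χ₁ = 2i(±s₁ ± s₂ ± s₃) and gives one of the four values. Any other one has χ₁ = 2(r_j
- r_k) ± 2is_b; then real ν₁ forces r_j = r_k, and real ν₂ forces s_j = s_k, which distinctness
forbids (`corresponds_cases`).

At an extremum of |p|² both first derivatives vanish. By the NLS equation this makes p'/p imaginary
and p''/p real, so Ψ₁₂ = ipq and Ψ₂₁ = ip*q with the same q, and 𝓡 is again a sum of two squares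
(`corresponds_of_jet`). A supremum or infimum need not be attained. However, the jets (p, p', p'')
are bounded, and g'² ≤ 4C|M - g| passes to limits, so a limiting jet satisfies the same conditions
(`corresponds_of_isLUB_or_isGLB`). -/

section

open Polynomial

/-! ### Sextics, their factorizations and arrangements of the roots -/

/-- The monic sextic with roots `lam`, expanded by Vieta's formulas. -/
theorem prod_sub_eq_Lam (lam : Fin 6 → ℂ) (l : ℂ) :
    ∏ i, (l - lam i) = l ^ 6 - Elim.Lam lam 1 * l ^ 5 + Elim.Lam lam 2 * l ^ 4
      - Elim.Lam lam 3 * l ^ 3 + Elim.Lam lam 4 * l ^ 2 - Elim.Lam lam 5 * l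
      + Elim.Lam lam 6 := by
  have h := Multiset.prod_X_sub_X_eq_sum_esymm (Multiset.map lam Finset.univ.val)
  have h2 := congrArg (eval l) h
  have h0 : (Multiset.map lam Finset.univ.val).esymm 0 = 1 := by simp [Multiset.esymm]
  simp only [Multiset.map_map, Function.comp_def, Multiset.card_map, Finset.card_val,
    Finset.card_univ, Fintype.card_fin, Finset.sum_range_succ, Finset.sum_range_zero, h0] at h2
  have h3 : (Multiset.map (fun x => X - C (lam x)) (Finset.univ : Finset (Fin 6)).val).prod
      = ∏ i, (X - C (lam i)) := rfl
  rw [h3] at h2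
  simp only [eval_prod, eval_sub, eval_X, eval_C] at h2
  rw [h2]
  simp [Elim.Lam]
  ring

/-- A complex polynomial function of degree at most five that vanishes identically has zero
coefficients; stated for two monic sextics. -/
theorem sextic_coeff_unique {a₁ a₂ a₃ a₄ a₅ a₆ b₁ b₂ b₃ b₄ b₅ b₆ : ℂ}
    (h : ∀ l : ℂ, l ^ 6 - a₁ * l ^ 5 + a₂ * l ^ 4 - a₃ * l ^ 3 + a₄ * l ^ 2 - a₅ * l + a₆
      = l ^ 6 - b₁ * l ^ 5 + b₂ * l ^ 4 - b₃ * l ^ 3 + b₄ * l ^ 2 - b₅ * l + b₆) :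
    a₁ = b₁ ∧ a₂ = b₂ ∧ a₃ = b₃ ∧ a₄ = b₄ ∧ a₅ = b₅ ∧ a₆ = b₆ := by
  -- The difference has degree at most five, so six points suffice; the pairs ±1, ±2 separate even
  -- from odd coefficients.
  have h0 := h 0
  have h1 := h 1
  have h2 := h (-1)
  have h3 := h 2
  have h4 := h (-2)
  have h5 := h 3
  have e6 : a₆ = b₆ := by linear_combination h0
  subst e6
  have e2 : a₂ = b₂ := by linear_combination (h3 + h4) / 24 - (h1 + h2) / 6
  have e4 : a₄ = b₄ := by linear_combination (h1 + h2) / 2 - e2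
  subst e2 e4
  have o1 : (a₁ + a₃ + a₅) = (b₁ + b₃ + b₅) := by linear_combination -h1
  have o2 : (16 * a₁ + 4 * a₃ + a₅) = (16 * b₁ + 4 * b₃ + b₅) := by linear_combination -h3 / 2
  have o3 : (81 * a₁ + 9 * a₃ + a₅) = (81 * b₁ + 9 * b₃ + b₅) := by linear_combination -h5 / 3
  have e1 : a₁ = b₁ := by linear_combination ((o3 - o1) / 8 - (o2 - o1) / 3) / 5
  subst e1
  have e3 : a₃ = b₃ := by linear_combination (o2 - o1) / 3
  subst e3
  exact ⟨rfl, rfl, rfl, rfl, by linear_combination o1, rfl⟩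

/-- The symmetric functions of the branch points in terms of those of two triples. -/
theorem Lam_eq_of_perm (lam : Fin 6 → ℂ) (π : Equiv.Perm (Fin 6)) (f₁ f₂ f₃ g₁ g₂ g₃ : ℂ)
    (hf₁ : f₁ = lam (π 0) + lam (π 1) + lam (π 2))
    (hf₂ : f₂ = lam (π 0) * lam (π 1) + lam (π 0) * lam (π 2) + lam (π 1) * lam (π 2))
    (hf₃ : f₃ = lam (π 0) * lam (π 1) * lam (π 2))
    (hg₁ : g₁ = lam (π 3) + lam (π 4) + lam (π 5))
    (hg₂ : g₂ = lam (π 3) * lam (π 4) + lam (π 3) * lam (π 5) + lam (π 4) * lam (π 5))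
    (hg₃ : g₃ = lam (π 3) * lam (π 4) * lam (π 5)) :
    Elim.Lam lam 1 = f₁ + g₁ ∧ Elim.Lam lam 2 = f₂ + g₂ + f₁ * g₁ ∧
    Elim.Lam lam 3 = f₃ + g₃ + f₁ * g₂ + f₂ * g₁ ∧
    Elim.Lam lam 4 = f₁ * g₃ + f₃ * g₁ + f₂ * g₂ ∧
    Elim.Lam lam 5 = f₂ * g₃ + f₃ * g₂ ∧ Elim.Lam lam 6 = f₃ * g₃ := by
  apply sextic_coeff_unique
  intro l
  rw [← prod_sub_eq_Lam, ← Equiv.prod_comp π, Fin.prod_univ_six]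
  subst hf₁ hf₂ hf₃ hg₁ hg₂ hg₃
  ring

/-- A monic complex cubic has three roots. -/
theorem exists_roots_cubic (a₂ a₁ a₀ : ℂ) :
    ∃ x y z : ℂ, ∀ l : ℂ, l ^ 3 + a₂ * l ^ 2 + a₁ * l + a₀ = (l - x) * (l - y) * (l - z) := by
  set q : ℂ[X] := X ^ 3 + C a₂ * X ^ 2 + C a₁ * X + C a₀ with hq
  have hdeg : q.natDegree = 3 := by rw [hq]; compute_degree!
  have hmon : q.Monic := by rw [hq]; monicity!
  have hs := IsAlgClosed.splits q
  have hc := hs.natDegree_eq_card_roots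
  rw [hdeg] at hc
  obtain ⟨x, y, z, hxyz⟩ := Multiset.card_eq_three.1 hc.symm
  refine ⟨x, y, z, fun l => ?_⟩
  have h := congrArg (eval l) (hs.eq_prod_roots_of_monic hmon)
  rw [hxyz] at h
  simp [hq] at h
  rw [h]; ring

/-- Two monic sextics with the same values have the same roots up to a permutation, if the roots of
one of them are distinct. -/
theorem exists_perm_of_prod_eq {lam y : Fin 6 → ℂ} (hns : Function.Injective lam)
    (h : ∀ l : ℂ, ∏ i, (l - lam i) = ∏ i, (l - y i)) :
    ∃ π : Equiv.Perm (Fin 6), ∀ i, lam (π i) = y i := by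
  have hpoly : ∏ i, (X - C (lam i)) = ∏ i, (X - C (y i)) :=
    Polynomial.funext fun l => by simpa [eval_prod] using h l
  have key : ∀ g : Fin 6 → ℂ, (∏ i, (X - C (g i))).roots = Finset.univ.val.map g := fun g => by
    rw [← roots_multiset_prod_X_sub_C (Finset.univ.val.map g), Multiset.map_map]
    rfl
  have hroots : Finset.univ.val.map lam = Finset.univ.val.map y := by
    rw [← key, ← key, hpoly]
  -- Simplicity of the roots passes to `y`; it is what makes the chosen index map `g` injective.
  have hy : Function.Injective y := by
    have hn : (Finset.univ.val.map y).Nodup := hroots ▸ Finset.univ.nodup.map hns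
    exact fun a b hab => Multiset.inj_on_of_nodup_map hn a (by simp) b (by simp) hab
  have hex : ∀ i, ∃ j, lam j = y i := fun i => by
    have : y i ∈ Finset.univ.val.map lam := hroots ▸ Multiset.mem_map_of_mem y (by simp)
    obtain ⟨j, -, hj⟩ := Multiset.mem_map.1 this
    exact ⟨j, hj⟩
  choose g hg using hex
  have hginj : Function.Injective g := fun a b hab => hy (by rw [← hg, ← hg, hab])
  exact ⟨Equiv.ofBijective g (Finite.injective_iff_bijective.1 hginj), hg⟩

/-- If the sextic is a sum of two squares `A² + B²` with `A` a monic cubic and `B` quadratic, the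
factors `A ± i B` split the branch points into two triples, which gives a corresponding pair. -/
theorem corresponds_of_sq_add_sq {lam : Fin 6 → ℂ} (hns : Function.Injective lam)
    {a₂ a₁ a₀ n b₁ b₀ : ℂ}
    (h : ∀ l : ℂ, ∏ i, (l - lam i)
      = (l ^ 3 + a₂ * l ^ 2 + a₁ * l + a₀) ^ 2 + (n * l ^ 2 + b₁ * l + b₀) ^ 2) :
    Corresponds lam (n ^ 2) (-4 * n * (n * a₂ - b₁)) := by
  obtain ⟨x, y, z, hF⟩ := exists_roots_cubic (a₂ + Complex.I * n) (a₁ + Complex.I * b₁)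
    (a₀ + Complex.I * b₀)
  obtain ⟨u, v, w, hG⟩ := exists_roots_cubic (a₂ - Complex.I * n) (a₁ - Complex.I * b₁)
    (a₀ - Complex.I * b₀)
  obtain ⟨π, hπ⟩ := exists_perm_of_prod_eq (y := ![x, y, z, u, v, w]) hns (fun l => by
    rw [h l, Fin.prod_univ_six]
    have : (l ^ 3 + a₂ * l ^ 2 + a₁ * l + a₀) ^ 2 + (n * l ^ 2 + b₁ * l + b₀) ^ 2
      = ((l - x) * (l - y) * (l - z)) * ((l - u) * (l - v) * (l - w)) := by
      rw [← hF, ← hG]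
      linear_combination ((n * l ^ 2 + b₁ * l + b₀) ^ 2) * Complex.I_sq
    rw [this]
    simp
    ring)
  have h0 := hπ 0
  have h1 := hπ 1
  have h2 := hπ 2
  have h3 := hπ 3
  have h4 := hπ 4
  have h5 := hπ 5
  simp at h0 h1 h2 h3 h4 h5
  -- Vieta's relations for both cubics, read off from the values at 0 and ±1.
  have f1 : x + y + z = -(a₂ + Complex.I * n) := by
    linear_combination (hF 1 + hF (-1)) / 2 - hF 0
  have f2 : x * y + x * z + y * z = a₁ + Complex.I * b₁ := by
    linear_combination (hF (-1) - hF 1) / 2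
  have g1 : u + v + w = -(a₂ - Complex.I * n) := by
    linear_combination (hG 1 + hG (-1)) / 2 - hG 0
  have g2 : u * v + u * w + v * w = a₁ - Complex.I * b₁ := by
    linear_combination (hG (-1) - hG 1) / 2
  have c1 : chi1 lam π = -2 * Complex.I * n := by
    simp only [chi1, h0, h1, h2, h3, h4, h5]
    linear_combination f1 - g1
  have c2 : chi2 lam π = 4 * Complex.I * (n * a₂ - b₁) := by
    simp only [chi2, h0, h1, h2, h3, h4, h5]
    linear_combination (x + y + z - (a₂ + Complex.I * n)) * f1
      - (u + v + w - (a₂ - Complex.I * n)) * g1 - 2 * f2 + 2 * g2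
  refine ⟨π, ?_, ?_⟩
  · rw [c1]; linear_combination n ^ 2 * Complex.I_sq
  · rw [c1, c2]; linear_combination (-4 * n * (n * a₂ - b₁)) * Complex.I_sq

/-! ### Common zeros of the eliminated equations and arrangements -/

namespace Elim

/-- The point values of the polynomials `S1, …, S4` in `(ν₁, ν₂)`. -/
theorem evalEval_S (L : ℕ → ℂ) (N z : ℂ) :
    evalEval N z (S1 L) = -1 / 2 * z + L 1 * N ∧
    evalEval N z (S2 L) = -1 / 4 * L 1 * z - 1 / 4 * N ^ 2
      + (-5 / 64 * L 1 ^ 4 + 3 / 8 * L 1 ^ 2 * L 2 - 1 / 4 * L 2 ^ 2 - 1 / 2 * L 1 * L 3 + L 4)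
      + (1 / 2 * L 2 + 1 / 8 * L 1 ^ 2) * N ∧
    evalEval N z (S3 L) = 1 / 4 * N * z + (1 / 16 * L 1 ^ 2 - 1 / 4 * L 2) * z
      - 1 / 4 * L 1 * N ^ 2
      + (1 / 64 * L 1 ^ 5 - 1 / 8 * L 1 ^ 3 * L 2 + 1 / 8 * L 1 ^ 2 * L 3 + 1 / 4 * L 1 * L 2 ^ 2
        - 1 / 2 * L 2 * L 3 + L 5)
      + 1 / 2 * L 3 * N ∧
    evalEval N z (S4 L) = 1 / 8 * L 1 * N * z - 1 / 16 * z ^ 2 - 1 / 16 * L 1 ^ 2 * N ^ 2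
      + (-1 / 32 * L 1 ^ 3 + 1 / 8 * L 1 * L 2 - 1 / 4 * L 3) * z
      + (-1 / 256 * L 1 ^ 6 + 1 / 32 * L 1 ^ 4 * L 2 - 1 / 16 * L 1 ^ 3 * L 3
        - 1 / 16 * L 1 ^ 2 * L 2 ^ 2 + 1 / 4 * L 1 * L 2 * L 3 - 1 / 4 * L 3 ^ 2 + L 6)
      + (1 / 32 * L 1 ^ 4 - 1 / 8 * L 1 ^ 2 * L 2 + 1 / 4 * L 1 * L 3) * N := by
  simp only [S1, S2, S3, S4, k, n1, n2, evalEval_add, evalEval_sub, evalEval_mul, evalEval_pow,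
    evalEval_C, evalEval_X, eval_C, eval_X]
  exact ⟨trivial, trivial, trivial, trivial⟩

theorem evalEval_H3 (L : ℕ → ℂ) (N z : ℂ) :
    evalEval N z (H3 L) = 1 / 8 * evalEval N z (S1 L) ^ 3
      - 1 / 2 * N * evalEval N z (S1 L) * evalEval N z (S2 L) + N ^ 2 * evalEval N z (S3 L) := by
  simp only [H3, k, n1, evalEval_add, evalEval_sub, evalEval_mul, evalEval_pow,
    evalEval_C, eval_C, eval_X]

theorem evalEval_discr (L : ℕ → ℂ) (N z : ℂ) :
    evalEval N z (H2 L ^ 2 - 4 * H4 L)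
      = (-(3 / 8) * evalEval N z (S1 L) ^ 2 + N * evalEval N z (S2 L)) ^ 2
        - 4 * (-(3 / 256) * evalEval N z (S1 L) ^ 4
          + 1 / 16 * N * evalEval N z (S1 L) ^ 2 * evalEval N z (S2 L)
          - 1 / 4 * N ^ 2 * evalEval N z (S1 L) * evalEval N z (S3 L)
          + N ^ 3 * evalEval N z (S4 L)) := by
  have h4 : evalEval N z (4 : ℂ[X][X]) = 4 := evalEval_natCast N z 4
  simp only [H2, H4, k, n1, evalEval_add, evalEval_sub, evalEval_mul, evalEval_pow,
    evalEval_neg, evalEval_C, eval_C, eval_X, h4]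

/-- The polynomials `Sₖ` are the coefficients of the sextic minus the square of a cubic. -/
theorem sextic_eq_sq_add (L : ℕ → ℂ) (N z l : ℂ) :
    l ^ 6 - L 1 * l ^ 5 + L 2 * l ^ 4 - L 3 * l ^ 3 + L 4 * l ^ 2 - L 5 * l + L 6
      = (l ^ 3 + -(L 1 / 2) * l ^ 2 + (L 2 - L 1 ^ 2 / 4 - N) / 2 * l
          + (evalEval N z (S1 L) - L 3 + (L 2 - L 1 ^ 2 / 4 - N) / 2 * L 1) / 2) ^ 2
        + (N * l ^ 4 - evalEval N z (S1 L) * l ^ 3 + evalEval N z (S2 L) * l ^ 2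
          - evalEval N z (S3 L) * l + evalEval N z (S4 L)) := by
  obtain ⟨h1, h2, h3, h4⟩ := evalEval_S L N z
  rw [h1, h2, h3, h4]
  ring

/-- For an arrangement of the branch points, the quartic with coefficients `Sₖ` is minus a quarter
of the square of the difference of the two cubic factors. -/
theorem exists_S_eq_of_corresponds {lam : Fin 6 → ℂ} {N z : ℂ} (h : Corresponds lam N z) :
    ∃ d₁ d₂ d₃ : ℂ, N = -(1 / 4) * d₁ ^ 2 ∧ evalEval N z (S1 (Lam lam)) = -(1 / 2) * d₁ * d₂ ∧
      evalEval N z (S2 (Lam lam)) = -(1 / 4) * (d₂ ^ 2 + 2 * d₁ * d₃) ∧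
      evalEval N z (S3 (Lam lam)) = -(1 / 2) * d₂ * d₃ ∧
      evalEval N z (S4 (Lam lam)) = -(1 / 4) * d₃ ^ 2 := by
  obtain ⟨π, hN, hz⟩ := h
  -- Opaque names for the symmetric functions of the two triples keep the identities below free of
  -- the six individual roots.
  obtain ⟨f₁, hf₁⟩ : ∃ f, f = lam (π 0) + lam (π 1) + lam (π 2) := ⟨_, rfl⟩
  obtain ⟨f₂, hf₂⟩ : ∃ f, f = lam (π 0) * lam (π 1) + lam (π 0) * lam (π 2)
    + lam (π 1) * lam (π 2) := ⟨_, rfl⟩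
  obtain ⟨f₃, hf₃⟩ : ∃ f, f = lam (π 0) * lam (π 1) * lam (π 2) := ⟨_, rfl⟩
  obtain ⟨g₁, hg₁⟩ : ∃ f, f = lam (π 3) + lam (π 4) + lam (π 5) := ⟨_, rfl⟩
  obtain ⟨g₂, hg₂⟩ : ∃ f, f = lam (π 3) * lam (π 4) + lam (π 3) * lam (π 5)
    + lam (π 4) * lam (π 5) := ⟨_, rfl⟩
  obtain ⟨g₃, hg₃⟩ : ∃ f, f = lam (π 3) * lam (π 4) * lam (π 5) := ⟨_, rfl⟩
  obtain ⟨L1, L2, L3, L4, L5, L6⟩ := Lam_eq_of_perm lam π f₁ f₂ f₃ g₁ g₂ g₃ hf₁ hf₂ hf₃ hg₁ hg₂ hg₃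
  have c1 : chi1 lam π = f₁ - g₁ := by rw [chi1, hf₁, hg₁]; ring
  have c2 : chi2 lam π = f₁ ^ 2 - 2 * f₂ - g₁ ^ 2 + 2 * g₂ := by
    rw [chi2, hf₁, hf₂, hg₁, hg₂]; ring
  rw [c1] at hN hz
  rw [c2] at hz
  obtain ⟨h1, h2, h3, h4⟩ := evalEval_S (Lam lam) N z
  refine ⟨f₁ - g₁, f₂ - g₂, f₃ - g₃, hN, ?_, ?_, ?_, ?_⟩
  · rw [h1, L1, hN, hz]; ring
  · rw [h2, L1, L2, L3, L4, hN, hz]; ring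
  · rw [h3, L1, L2, L3, L5, hN, hz]; ring
  · rw [h4, L1, L2, L3, L6, hN, hz]; ring

/-- A perfect square quartic stays one after depression, so its linear term vanishes and its
constant term is the square of half its quadratic coefficient. -/
theorem evalEval_H3_eq_zero_of_corresponds {lam : Fin 6 → ℂ} {N z : ℂ}
    (h : Corresponds lam N z) :
    evalEval N z (H3 (Lam lam)) = 0 ∧
      evalEval N z (H2 (Lam lam) ^ 2 - 4 * H4 (Lam lam)) = 0 := by
  obtain ⟨d₁, d₂, d₃, hN, h1, h2, h3, h4⟩ := exists_S_eq_of_corresponds h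
  rw [evalEval_H3, evalEval_discr, h1, h2, h3, h4, hN]
  constructor <;> ring

/-- A common zero of the two eliminated equations with `ν₁ ≠ 0` comes from an arrangement of the
branch points. -/
theorem exists_corresponds_of_evalEval_eq_zero {lam : Fin 6 → ℂ} (hns : Function.Injective lam)
    {N z : ℂ} (hN : N ≠ 0) (h3 : evalEval N z (H3 (Lam lam)) = 0)
    (h4 : evalEval N z (H2 (Lam lam) ^ 2 - 4 * H4 (Lam lam)) = 0) :
    ∃ w, Corresponds lam N w := by
  rw [evalEval_H3] at h3
  rw [evalEval_discr] at h4
  obtain ⟨n, rfl⟩ : ∃ n : ℂ, N = n ^ 2 :=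
    (IsAlgClosed.exists_pow_nat_eq N two_pos).imp fun _ h => h.symm
  have hn : n ≠ 0 := fun h => hN (by simp [h])
  obtain ⟨e₁, he₁⟩ : ∃ e, evalEval (n ^ 2) z (S1 (Lam lam)) = n ^ 2 * e :=
    ⟨_, (mul_div_cancel₀ _ hN).symm⟩
  obtain ⟨e₂, he₂⟩ : ∃ e, evalEval (n ^ 2) z (S2 (Lam lam)) = n ^ 2 * e :=
    ⟨_, (mul_div_cancel₀ _ hN).symm⟩
  obtain ⟨e₃, he₃⟩ : ∃ e, evalEval (n ^ 2) z (S3 (Lam lam)) = n ^ 2 * e :=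
    ⟨_, (mul_div_cancel₀ _ hN).symm⟩
  obtain ⟨e₄, he₄⟩ : ∃ e, evalEval (n ^ 2) z (S4 (Lam lam)) = n ^ 2 * e :=
    ⟨_, (mul_div_cancel₀ _ hN).symm⟩
  rw [he₁, he₂, he₃] at h3
  rw [he₁, he₂, he₃, he₄] at h4
  have h3' : 1 / 8 * e₁ ^ 3 - 1 / 2 * e₁ * e₂ + e₃ = 0 := by
    apply mul_left_cancel₀ (pow_ne_zero 6 hn); linear_combination h3
  have h4' : (-(3 / 8) * e₁ ^ 2 + e₂) ^ 2 - 4 * (-(3 / 256) * e₁ ^ 4 + 1 / 16 * e₁ ^ 2 * e₂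
      - 1 / 4 * e₁ * e₃ + e₄) = 0 := by
    apply mul_left_cancel₀ (pow_ne_zero 8 hn); linear_combination h4
  -- With x = l - e₁/4 the quartic divided by n² is (x² + Σ̂₂/2)². Expanding n(x² + Σ̂₂/2) in l
  -- gives `b₁` and `b₀`; the cubic is that of `sextic_eq_sq_add`.
  refine ⟨_, corresponds_of_sq_add_sq hns (a₂ := -(Lam lam 1 / 2))
    (a₁ := (Lam lam 2 - Lam lam 1 ^ 2 / 4 - n ^ 2) / 2)
    (a₀ := (n ^ 2 * e₁ - Lam lam 3 + (Lam lam 2 - Lam lam 1 ^ 2 / 4 - n ^ 2) / 2 * Lam lam 1) / 2)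
    (n := n) (b₁ := -(n * e₁ / 2))
    (b₀ := n * (e₁ ^ 2 / 16 + (-(3 / 8) * e₁ ^ 2 + e₂) / 2)) (fun l => ?_)⟩
  rw [prod_sub_eq_Lam, sextic_eq_sq_add _ (n ^ 2) z l, he₁, he₂, he₃, he₄]
  linear_combination (-(n ^ 2) * (l - e₁ / 4)) * h3' - n ^ 2 / 4 * h4'

/-- At `ν₁ = 0` an arrangement exists if and only if the quadratic `S₂ l² - S₃ l + S₄` has a double
root. -/
theorem discr_eq_zero_of_corresponds_zero {lam : Fin 6 → ℂ} {z : ℂ} (h : Corresponds lam 0 z) :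
    evalEval 0 0 (S3 (Lam lam)) ^ 2
      - 4 * evalEval 0 0 (S2 (Lam lam)) * evalEval 0 0 (S4 (Lam lam)) = 0 := by
  have hz : z = 0 := by
    obtain ⟨π, hN, hz⟩ := h
    have : chi1 lam π = 0 := by simpa using hN
    simpa [this] using hz
  subst hz
  obtain ⟨d₁, d₂, d₃, hN, h1, h2, h3, h4⟩ := exists_S_eq_of_corresponds h
  have hd : d₁ = 0 := by simpa using hN
  rw [h2, h3, h4, hd]
  ring

/-- At ν₁ = ν₂ = 0 the quartic loses its two top terms. Zero discriminant makes the remaining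
quadratic a square (b₁l + b₀)², and the two-squares factorization applies with n = 0. -/
theorem exists_corresponds_zero_of_discr_eq_zero {lam : Fin 6 → ℂ}
    (hns : Function.Injective lam)
    (h : evalEval 0 0 (S3 (Lam lam)) ^ 2
      - 4 * evalEval 0 0 (S2 (Lam lam)) * evalEval 0 0 (S4 (Lam lam)) = 0) :
    ∃ w, Corresponds lam 0 w := by
  have h1 : evalEval 0 0 (S1 (Lam lam)) = 0 := by rw [(evalEval_S _ 0 0).1]; simp
  obtain ⟨b₁, b₀, h2, h3, h4⟩ : ∃ b₁ b₀ : ℂ, evalEval 0 0 (S2 (Lam lam)) = b₁ ^ 2 ∧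
      evalEval 0 0 (S3 (Lam lam)) = -2 * b₁ * b₀ ∧ evalEval 0 0 (S4 (Lam lam)) = b₀ ^ 2 := by
    generalize evalEval 0 0 (S2 (Lam lam)) = x₂ at *
    generalize evalEval 0 0 (S3 (Lam lam)) = x₃ at *
    generalize evalEval 0 0 (S4 (Lam lam)) = x₄ at *
    obtain ⟨b, rfl⟩ : ∃ b : ℂ, x₂ = b ^ 2 :=
      (IsAlgClosed.exists_pow_nat_eq x₂ two_pos).imp fun _ h => h.symm
    by_cases hb : b = 0
    · obtain ⟨e, rfl⟩ : ∃ e : ℂ, x₄ = e ^ 2 :=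
        (IsAlgClosed.exists_pow_nat_eq x₄ two_pos).imp fun _ h => h.symm
      refine ⟨b, e, rfl, ?_, rfl⟩
      simpa [hb] using h
    · refine ⟨b, -x₃ / (2 * b), rfl, by field_simp, ?_⟩
      field_simp
      linear_combination -h
  obtain ⟨w, hw⟩ : ∃ w, Corresponds lam (0 ^ 2) w :=
    ⟨_, corresponds_of_sq_add_sq hns (a₂ := -(Lam lam 1 / 2))
      (a₁ := (Lam lam 2 - Lam lam 1 ^ 2 / 4 - 0) / 2)
      (a₀ := (0 - Lam lam 3 + (Lam lam 2 - Lam lam 1 ^ 2 / 4 - 0) / 2 * Lam lam 1) / 2)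
      (n := 0) (b₁ := b₁) (b₀ := b₀) (fun l => by
      rw [prod_sub_eq_Lam, sextic_eq_sq_add _ 0 0 l, h1, h2, h3, h4]
      ring)⟩
  exact ⟨w, by simpa using hw⟩

end Elim

/-! ### The resultant and its explicit form -/

namespace Elim

theorem natDegree_map_discr_le (L : ℕ → ℂ) (N : ℂ) :
    ((H2 L ^ 2 - 4 * H4 L).map (evalRingHom N)).natDegree ≤ 4 := by
  simp only [H2, H4, S1, S2, S3, S4, k, n1, n2, Polynomial.map_add, Polynomial.map_sub,
    Polynomial.map_mul, Polynomial.map_pow, Polynomial.map_neg, Polynomial.map_C,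
    Polynomial.map_X, Polynomial.map_ofNat]
  compute_degree

/-- If the cubic `ν₁³ Σ̂₃` factors at `ν₁ = N` with roots `z₁, z₂, z₃`, the resultant at `N` is the
product of the values of the quartic at these roots, up to the power of the leading coefficient. -/
theorem eval_elimNu2 (L : ℕ → ℂ) (N z₁ z₂ z₃ : ℂ)
    (h : ∀ z, evalEval N z (H3 L) = -1 / 64 * ((z - z₁) * (z - z₂) * (z - z₃))) :
    (elimNu2 L).eval N = (-1 / 64) ^ 4 * (evalEval N z₁ (H2 L ^ 2 - 4 * H4 L)
      * evalEval N z₂ (H2 L ^ 2 - 4 * H4 L) * evalEval N z₃ (H2 L ^ 2 - 4 * H4 L)) := by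
  -- The leading coefficient -1/64 = (1/8)(-1/2)³ does not involve ν₁, so the degree in ν₂ stays
  -- three at every `N`.
  have hf : (H3 L).map (evalRingHom N)
      = C (-1 / 64) * (({z₁, z₂, z₃} : Multiset ℂ).map fun a => X - C a).prod := by
    refine Polynomial.funext fun z => ?_
    rw [map_evalRingHom_eval, h]
    simp [mul_assoc]
  have h64 : (-1 / 64 : ℂ) ≠ 0 := by norm_num
  have hmon : (({z₁, z₂, z₃} : Multiset ℂ).map fun a => X - C a).prod.Monic :=
    monic_multiset_prod_of_monic _ _ fun a _ => monic_X_sub_C a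
  have hdeg : ((H3 L).map (evalRingHom N)).natDegree = 3 := by
    rw [hf, natDegree_C_mul h64, natDegree_multiset_prod_X_sub_C_eq_card]
    rfl
  have hlead : ((H3 L).map (evalRingHom N)).leadingCoeff = -1 / 64 := by
    rw [hf, leadingCoeff_mul, leadingCoeff_C, hmon.leadingCoeff, mul_one]
  have hroots : ((H3 L).map (evalRingHom N)).roots = {z₁, z₂, z₃} := by
    rw [hf, roots_C_mul _ h64, roots_multiset_prod_X_sub_C]
  have hres := resultant_eq_prod_eval ((H3 L).map (evalRingHom N))
    ((H2 L ^ 2 - 4 * H4 L).map (evalRingHom N)) 4 (natDegree_map_discr_le L N)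
    (IsAlgClosed.splits _)
  rw [hdeg, resultant_map_map, hlead, hroots] at hres
  simp only [coe_evalRingHom] at hres
  rw [elimNu2, hres]
  simp only [map_evalRingHom_eval, Multiset.insert_eq_cons, Multiset.map_cons,
    Multiset.prod_cons, Multiset.map_singleton, Multiset.prod_singleton, mul_assoc]

/-! ### The eliminant in closed form

`a` is the mean of the roots of the sextic, and `m₂, …, m₆` are the elementary symmetric functions
of the roots shifted by `a`. -/

/-- For centred roots, κ is the linear coefficient of the monic cubic in `sextic_eq_sq_add`, while σ
and τ are the ν₂-free parts of S₂ and S₃; in particular σ = m₄ - κ². -/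
noncomputable def polyKappa (m₂ : ℂ) : ℂ[X] := C (1 / 2) * (C m₂ - X)

noncomputable def polySigma (m₂ m₄ : ℂ) : ℂ[X] :=
  C (-1 / 4) * X ^ 2 + C (m₂ / 2) * X + C (m₄ - m₂ ^ 2 / 4)

noncomputable def polyTau (m₂ m₃ m₅ : ℂ) : ℂ[X] := C (m₃ / 2) * X + C (m₅ - m₂ * m₃ / 2)

/-- Φ and τ determine the depressed cubic; A, B and C determine the quadratic remainder of the
quartic modulo that cubic. -/
noncomputable def polyA (m₂ m₄ : ℂ) : ℂ[X] :=
  polySigma m₂ m₄ + X * (2 * polyKappa m₂ - 4 * X)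

noncomputable def polyPhi (m₂ m₄ : ℂ) : ℂ[X] := polySigma m₂ m₄ - 2 * X * polyKappa m₂

noncomputable def polyB (m₂ m₃ m₅ : ℂ) : ℂ[X] := polyTau m₂ m₃ m₅ + C (4 * m₃) * X

noncomputable def polyCc (m₂ m₃ m₄ m₆ : ℂ) : ℂ[X] :=
  polySigma m₂ m₄ ^ 2 - C (4 * (m₆ - m₃ ^ 2 / 4)) * X

/-- D and H are the quotients in C = AΦ + ν₁D and Aτ - BΦ = ν₁H; these divisibilities let further
powers of ν₁ be extracted from the resultant. -/
noncomputable def polyD (m₂ m₃ m₄ m₆ : ℂ) : ℂ[X] :=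
  C (-4 * (m₆ - m₃ ^ 2 / 4)) + 4 * X * polyKappa m₂ ^ 2 + 4 * X * polySigma m₂ m₄
    - 8 * X ^ 2 * polyKappa m₂

noncomputable def polyH (m₂ m₃ m₄ m₅ : ℂ) : ℂ[X] :=
  (4 * polyKappa m₂ - 4 * X) * polyTau m₂ m₃ m₅ - C (4 * m₃) * polySigma m₂ m₄
    + C (8 * m₃) * X * polyKappa m₂

noncomputable def closedForm (m₂ m₃ m₄ m₅ m₆ : ℂ) : ℂ[X] :=
  polyCc m₂ m₃ m₄ m₆ * polyD m₂ m₃ m₄ m₆ ^ 2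
    + (polyD m₂ m₃ m₄ m₆ * polyB m₂ m₃ m₅
        * (3 * polyA m₂ m₄ * polyTau m₂ m₃ m₅ - polyB m₂ m₃ m₅ * polyPhi m₂ m₄)
      + polyB m₂ m₃ m₅ ^ 3 * polyTau m₂ m₃ m₅
      - X * polyA m₂ m₄ * polyH m₂ m₃ m₄ m₅ ^ 2)

/-- The term CD² dominates: C and D have degrees 4 and 3 with constant leading coefficients 1/16 and
4, and all other terms have degree at most 7. -/
theorem natDegree_closedForm (m₂ m₃ m₄ m₅ m₆ : ℂ) :
    (closedForm m₂ m₃ m₄ m₅ m₆).natDegree = 10 := by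
  have hk : (polyKappa m₂).natDegree ≤ 1 := by unfold polyKappa; compute_degree
  have hs : (polySigma m₂ m₄).natDegree ≤ 2 := by unfold polySigma; compute_degree
  have ht : (polyTau m₂ m₃ m₅).natDegree ≤ 1 := by unfold polyTau; compute_degree
  have hA : (polyA m₂ m₄).natDegree ≤ 2 := by
    unfold polyA polySigma polyKappa; compute_degree
  have hP : (polyPhi m₂ m₄).natDegree ≤ 2 := by
    unfold polyPhi polySigma polyKappa; compute_degree
  have hB : (polyB m₂ m₃ m₅).natDegree ≤ 1 := by unfold polyB polyTau; compute_degree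
  have hH : (polyH m₂ m₃ m₄ m₅).natDegree ≤ 2 := by
    unfold polyH polySigma polyKappa polyTau; compute_degree
  have hC : (polyCc m₂ m₃ m₄ m₆).natDegree = 4 := by
    unfold polyCc polySigma; compute_degree!
  have hD : (polyD m₂ m₃ m₄ m₆).natDegree = 3 := by
    unfold polyD polySigma polyKappa
    compute_degree!
  have hCD : (polyCc m₂ m₃ m₄ m₆ * polyD m₂ m₃ m₄ m₆ ^ 2).natDegree = 10 := by
    rw [natDegree_mul (fun h => by simp [h] at hC) (pow_ne_zero _ fun h => by simp [h] at hD),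
      natDegree_pow, hC, hD]
  have hrest : (polyD m₂ m₃ m₄ m₆ * polyB m₂ m₃ m₅
        * (3 * polyA m₂ m₄ * polyTau m₂ m₃ m₅ - polyB m₂ m₃ m₅ * polyPhi m₂ m₄)
      + polyB m₂ m₃ m₅ ^ 3 * polyTau m₂ m₃ m₅
      - X * polyA m₂ m₄ * polyH m₂ m₃ m₄ m₅ ^ 2).natDegree ≤ 7 := by
    have h3 : (3 * polyA m₂ m₄ * polyTau m₂ m₃ m₅).natDegree ≤ 3 :=
      natDegree_mul_le_of_le (natDegree_mul_le_of_le (natDegree_ofNat 3).le hA) ht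
    refine natDegree_sub_le_of_le (natDegree_add_le_of_le
      (natDegree_mul_le_of_le (natDegree_mul_le_of_le hD.le hB)
        (natDegree_sub_le_of_le h3 (natDegree_mul_le_of_le hB hP)))
      ((natDegree_mul_le_of_le (natDegree_pow_le_of_le 3 hB) ht)))
      (natDegree_mul_le_of_le (natDegree_mul_le_of_le natDegree_X_le hA)
        (natDegree_pow_le_of_le 2 hH)) |>.trans (by norm_num)
  rw [closedForm, natDegree_add_eq_left_of_natDegree_lt (by omega), hCD]

/-- `m₂, …, m₆` are the elementary symmetric functions of the roots shifted by their mean `a`. -/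
structure IsShift (L : ℕ → ℂ) (a m₂ m₃ m₄ m₅ m₆ : ℂ) : Prop where
  h1 : L 1 = 6 * a
  h2 : L 2 = m₂ + 15 * a ^ 2
  h3 : L 3 = m₃ + 4 * a * m₂ + 20 * a ^ 3
  h4 : L 4 = m₄ + 3 * a * m₃ + 6 * a ^ 2 * m₂ + 15 * a ^ 4
  h5 : L 5 = m₅ + 2 * a * m₄ + 3 * a ^ 2 * m₃ + 4 * a ^ 3 * m₂ + 6 * a ^ 5
  h6 : L 6 = m₆ + a * m₅ + a ^ 2 * m₄ + a ^ 3 * m₃ + a ^ 4 * m₂ + a ^ 6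

/-- The relations are triangular in a, m₂, …, m₆ and can be solved one after another. -/
theorem exists_isShift (L : ℕ → ℂ) : ∃ a m₂ m₃ m₄ m₅ m₆ : ℂ, IsShift L a m₂ m₃ m₄ m₅ m₆ := by
  obtain ⟨a, ha⟩ : ∃ a : ℂ, a = L 1 / 6 := ⟨_, rfl⟩
  obtain ⟨m₂, h₂⟩ : ∃ m, m = L 2 - 15 * a ^ 2 := ⟨_, rfl⟩
  obtain ⟨m₃, h₃⟩ : ∃ m, m = L 3 - 4 * a * m₂ - 20 * a ^ 3 := ⟨_, rfl⟩
  obtain ⟨m₄, h₄⟩ : ∃ m, m = L 4 - 3 * a * m₃ - 6 * a ^ 2 * m₂ - 15 * a ^ 4 := ⟨_, rfl⟩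
  obtain ⟨m₅, h₅⟩ : ∃ m, m = L 5 - 2 * a * m₄ - 3 * a ^ 2 * m₃ - 4 * a ^ 3 * m₂ - 6 * a ^ 5 :=
    ⟨_, rfl⟩
  refine ⟨a, m₂, m₃, m₄, m₅, L 6 - a * m₅ - a ^ 2 * m₄ - a ^ 3 * m₃ - a ^ 4 * m₂ - a ^ 6,
    ?_, ?_, ?_, ?_, ?_, ?_⟩
  · linear_combination -6 * ha
  · linear_combination -h₂
  · linear_combination -h₃
  · linear_combination -h₄
  · linear_combination -h₅
  · ring

variable {L : ℕ → ℂ} {a m₂ m₃ m₄ m₅ m₆ : ℂ}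

/-- In the shifted variable `s = -ν₂ / 2 + 2 a ν₁` the cubic has no quadratic term. -/
theorem IsShift.evalEval_H3 (h : IsShift L a m₂ m₃ m₄ m₅ m₆) (N s : ℂ) :
    evalEval N (-2 * (s - 2 * a * N)) (H3 L)
      = 1 / 8 * (s ^ 3 - 4 * N * (polyPhi m₂ m₄).eval N * s
          + 8 * N ^ 2 * (polyTau m₂ m₃ m₅).eval N) := by
  obtain ⟨e1, e2, e3, -⟩ := evalEval_S L N (-2 * (s - 2 * a * N))
  rw [Elim.evalEval_H3, e1, e2, e3, h.h1, h.h2, h.h3, h.h4, h.h5]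
  simp only [polyPhi, polyTau, polySigma, polyKappa, eval_add, eval_sub, eval_mul, eval_pow,
    eval_C, eval_X, eval_ofNat]
  ring

/-- Modulo the cubic, the quartic becomes quadratic. -/
theorem IsShift.evalEval_discr (h : IsShift L a m₂ m₃ m₄ m₅ m₆) (N s : ℂ) :
    evalEval N (-2 * (s - 2 * a * N)) (H2 L ^ 2 - 4 * H4 L)
      = 3 / 2 * s * evalEval N (-2 * (s - 2 * a * N)) (H3 L)
        + N * (-1 / 4 * (polyA m₂ m₄).eval N * s ^ 2 - 1 / 2 * N * (polyB m₂ m₃ m₅).eval N * s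
          + N * (polyCc m₂ m₃ m₄ m₆).eval N) := by
  obtain ⟨e1, e2, e3, e4⟩ := evalEval_S L N (-2 * (s - 2 * a * N))
  rw [Elim.evalEval_discr, Elim.evalEval_H3, e1, e2, e3, e4, h.h1, h.h2, h.h3, h.h4, h.h5, h.h6]
  simp only [polyA, polyB, polyCc, polyTau, polySigma, polyKappa, eval_add, eval_sub, eval_mul,
    eval_pow, eval_C, eval_X, eval_ofNat]
  ring

/-- The resultant of a depressed cubic and a quadratic. -/
theorem prod_quadratic_at_roots {x y z p q : ℂ} (α β γ : ℂ) (h1 : x + y + z = 0)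
    (h2 : x * y + x * z + y * z = p) (h3 : x * y * z = -q) :
    (α * x ^ 2 + β * x + γ) * (α * y ^ 2 + β * y + γ) * (α * z ^ 2 + β * z + γ)
      = α ^ 3 * q ^ 2 - α ^ 2 * β * p * q + α ^ 2 * γ * p ^ 2 + 3 * α * β * γ * q
        - 2 * α * γ ^ 2 * p - β ^ 3 * q + β ^ 2 * γ * p + γ ^ 3 := by
  obtain rfl : z = -x - y := by linear_combination h1
  obtain rfl : q = -(x * y * (-x - y)) := by linear_combination h3
  subst h2
  ring

theorem IsShift.eval_elimNu2 (h : IsShift L a m₂ m₃ m₄ m₅ m₆) (N : ℂ) :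
    (elimNu2 L).eval N = N ^ 8 * ((1 / 64) ^ 4 * (closedForm m₂ m₃ m₄ m₅ m₆).eval N) := by
  obtain ⟨x, y, z, hxyz⟩ := exists_roots_cubic 0 (-4 * N * (polyPhi m₂ m₄).eval N)
    (8 * N ^ 2 * (polyTau m₂ m₃ m₅).eval N)
  have hH : ∀ s, evalEval N (-2 * (s - 2 * a * N)) (H3 L)
      = 1 / 8 * ((s - x) * (s - y) * (s - z)) := fun s => by
    rw [h.evalEval_H3, ← hxyz s]; ring
  have hx : evalEval N (-2 * (x - 2 * a * N)) (H3 L) = 0 := by rw [hH]; ring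
  have hy : evalEval N (-2 * (y - 2 * a * N)) (H3 L) = 0 := by rw [hH]; ring
  have hz : evalEval N (-2 * (z - 2 * a * N)) (H3 L) = 0 := by rw [hH]; ring
  rw [Elim.eval_elimNu2 L N (-2 * (x - 2 * a * N)) (-2 * (y - 2 * a * N)) (-2 * (z - 2 * a * N))
    (fun w => by
      have := hH (-w / 2 + 2 * a * N)
      rw [show -2 * (-w / 2 + 2 * a * N - 2 * a * N) = w by ring] at this
      rw [this]; ring)]
  rw [h.evalEval_discr, h.evalEval_discr, h.evalEval_discr, hx, hy, hz]
  have e1 : x + y + z = 0 := by linear_combination (hxyz 1 + hxyz (-1)) / 2 - hxyz 0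
  have e2 : x * y + x * z + y * z = -4 * N * (polyPhi m₂ m₄).eval N := by
    linear_combination (hxyz (-1) - hxyz 1) / 2
  have e3 : x * y * z = -(8 * N ^ 2 * (polyTau m₂ m₃ m₅).eval N) := by
    linear_combination hxyz 0
  have hprod := prod_quadratic_at_roots (-1 / 4 * (polyA m₂ m₄).eval N)
    (-1 / 2 * N * (polyB m₂ m₃ m₅).eval N) (N * (polyCc m₂ m₃ m₄ m₆).eval N) e1 e2 e3
  -- The three values contribute N³. In the product of the quadratics, N³C(C - AΦ)² becomes N⁵CD² by
  -- `hc`. Substituting `hc` in the other terms leaves -N⁴A(Aτ - BΦ)² plus multiples of N⁵, and `hh`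
  -- turns that square into -N⁶AH². This yields N⁸ in all.
  have hc : (polyCc m₂ m₃ m₄ m₆).eval N
      = (polyA m₂ m₄).eval N * (polyPhi m₂ m₄).eval N + N * (polyD m₂ m₃ m₄ m₆).eval N := by
    simp only [polyA, polyPhi, polyCc, polyD, polySigma, polyKappa, eval_add, eval_sub,
      eval_mul, eval_pow, eval_C, eval_X, eval_ofNat]
    ring
  have hh : N * (polyH m₂ m₃ m₄ m₅).eval N = (polyA m₂ m₄).eval N * (polyTau m₂ m₃ m₅).eval N
      - (polyB m₂ m₃ m₅).eval N * (polyPhi m₂ m₄).eval N := by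
    simp only [polyA, polyPhi, polyB, polyH, polyTau, polySigma, polyKappa, eval_add, eval_sub,
      eval_mul, eval_pow, eval_C, eval_X, eval_ofNat]
    ring
  have hF : (closedForm m₂ m₃ m₄ m₅ m₆).eval N
      = (polyCc m₂ m₃ m₄ m₆).eval N * (polyD m₂ m₃ m₄ m₆).eval N ^ 2
      + ((polyD m₂ m₃ m₄ m₆).eval N * (polyB m₂ m₃ m₅).eval N
        * (3 * (polyA m₂ m₄).eval N * (polyTau m₂ m₃ m₅).eval N
          - (polyB m₂ m₃ m₅).eval N * (polyPhi m₂ m₄).eval N)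
      + (polyB m₂ m₃ m₅).eval N ^ 3 * (polyTau m₂ m₃ m₅).eval N
      - N * (polyA m₂ m₄).eval N * (polyH m₂ m₃ m₄ m₅).eval N ^ 2) := by
    simp only [closedForm, eval_add, eval_sub, eval_mul, eval_pow, eval_X, eval_ofNat]
  rw [hF]
  generalize (polyCc m₂ m₃ m₄ m₆).eval N = c at *
  generalize (polyA m₂ m₄).eval N = A at *
  generalize (polyB m₂ m₃ m₅).eval N = B at *
  generalize (polyD m₂ m₃ m₄ m₆).eval N = D at *
  generalize (polyH m₂ m₃ m₄ m₅).eval N = H at *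
  generalize (polyPhi m₂ m₄).eval N = Φ at *
  generalize (polyTau m₂ m₃ m₅).eval N = τ at *
  subst hc
  linear_combination (1 / 64) ^ 4 * N ^ 3 * hprod
    + (1 / 64) ^ 4 * N ^ 7 * A * (N * H + A * τ - B * Φ) * hh

theorem IsShift.elimNu2_eq (h : IsShift L a m₂ m₃ m₄ m₅ m₆) :
    elimNu2 L = X ^ 8 * (C ((1 / 64) ^ 4) * closedForm m₂ m₃ m₄ m₅ m₆) :=
  Polynomial.funext fun N => by
    rw [h.eval_elimNu2]
    simp only [eval_mul, eval_pow, eval_X, eval_C]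

/-- The value of the closed form at zero is the square of a discriminant. -/
theorem IsShift.eval_closedForm_zero (h : IsShift L a m₂ m₃ m₄ m₅ m₆) :
    (closedForm m₂ m₃ m₄ m₅ m₆).eval 0
      = (evalEval 0 0 (S3 L) ^ 2 - 4 * evalEval 0 0 (S2 L) * evalEval 0 0 (S4 L)) ^ 2 := by
  obtain ⟨-, e2, e3, e4⟩ := evalEval_S L 0 0
  rw [e2, e3, e4, h.h1, h.h2, h.h3, h.h4, h.h5, h.h6]
  simp only [closedForm, polyA, polyB, polyCc, polyD, polyH, polyPhi, polyTau, polySigma,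
    polyKappa, eval_add, eval_sub, eval_mul, eval_pow, eval_C, eval_X, eval_ofNat]
  ring

end Elim

/-! ### The roots of P -/

theorem polyP_eq {lam : Fin 6 → ℂ} {a m₂ m₃ m₄ m₅ m₆ : ℂ}
    (h : Elim.IsShift (Elim.Lam lam) a m₂ m₃ m₄ m₅ m₆) :
    polyP lam = C ((1 / 64) ^ 4) * Elim.closedForm m₂ m₃ m₄ m₅ m₆ := by
  rw [polyP, h.elimNu2_eq, mul_divByMonic_cancel_left _ (monic_X_pow 8)]

theorem natDegree_polyP (lam : Fin 6 → ℂ) : (polyP lam).natDegree = 10 := by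
  obtain ⟨a, m₂, m₃, m₄, m₅, m₆, h⟩ := Elim.exists_isShift (Elim.Lam lam)
  rw [polyP_eq h, natDegree_C_mul (by norm_num), Elim.natDegree_closedForm]

theorem X_pow_mul_polyP (lam : Fin 6 → ℂ) :
    Elim.elimNu2 (Elim.Lam lam) = X ^ 8 * polyP lam := by
  obtain ⟨a, m₂, m₃, m₄, m₅, m₆, h⟩ := Elim.exists_isShift (Elim.Lam lam)
  rw [polyP_eq h, h.elimNu2_eq]

theorem isRoot_polyP_zero_iff (lam : Fin 6 → ℂ) : (polyP lam).IsRoot 0 ↔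
    evalEval 0 0 (Elim.S3 (Elim.Lam lam)) ^ 2
      - 4 * evalEval 0 0 (Elim.S2 (Elim.Lam lam)) * evalEval 0 0 (Elim.S4 (Elim.Lam lam)) = 0 := by
  obtain ⟨a, m₂, m₃, m₄, m₅, m₆, h⟩ := Elim.exists_isShift (Elim.Lam lam)
  rw [polyP_eq h, IsRoot, eval_mul, eval_C, h.eval_closedForm_zero]
  simp

/-- Away from zero, the roots of `P` are the values of `ν₁` for which the two eliminated equations
have a common solution `ν₂`. -/
theorem isRoot_polyP_iff_of_ne_zero (lam : Fin 6 → ℂ) {N : ℂ} (hN : N ≠ 0) :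
    (polyP lam).IsRoot N ↔ ∃ z, evalEval N z (Elim.H3 (Elim.Lam lam)) = 0 ∧
      evalEval N z (Elim.H2 (Elim.Lam lam) ^ 2 - 4 * Elim.H4 (Elim.Lam lam)) = 0 := by
  have hroot : (polyP lam).IsRoot N ↔ (Elim.elimNu2 (Elim.Lam lam)).eval N = 0 := by
    rw [X_pow_mul_polyP, eval_mul, eval_pow, eval_X, IsRoot]
    simp [hN]
  rw [hroot]
  obtain ⟨a, m₂, m₃, m₄, m₅, m₆, h⟩ := Elim.exists_isShift (Elim.Lam lam)
  obtain ⟨x, y, z, hxyz⟩ := exists_roots_cubic 0 (-4 * N * (Elim.polyPhi m₂ m₄).eval N)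
    (8 * N ^ 2 * (Elim.polyTau m₂ m₃ m₅).eval N)
  have hH : ∀ w, evalEval N w (Elim.H3 (Elim.Lam lam)) = -1 / 64
      * ((w - -2 * (x - 2 * a * N)) * (w - -2 * (y - 2 * a * N)) * (w - -2 * (z - 2 * a * N))) := by
    intro w
    have := h.evalEval_H3 N (-w / 2 + 2 * a * N)
    rw [show -2 * (-w / 2 + 2 * a * N - 2 * a * N) = w by ring] at this
    rw [this]
    linear_combination 1 / 8 * hxyz (-w / 2 + 2 * a * N)
  rw [Elim.eval_elimNu2 _ _ _ _ _ hH]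
  constructor
  · intro h0
    rcases mul_eq_zero.1 ((mul_eq_zero.1 h0).resolve_left (by norm_num)) with h1 | h1
    · rcases mul_eq_zero.1 h1 with h2 | h2
      · exact ⟨_, by rw [hH]; ring, h2⟩
      · exact ⟨_, by rw [hH]; ring, h2⟩
    · exact ⟨_, by rw [hH]; ring, h1⟩
  · rintro ⟨w, h3, h4⟩
    rw [hH] at h3
    rcases mul_eq_zero.1 ((mul_eq_zero.1 h3).resolve_left (by norm_num)) with h1 | h1
    · rcases mul_eq_zero.1 h1 with h2 | h2
      · rw [← sub_eq_zero.1 h2, h4]; ring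
      · rw [← sub_eq_zero.1 h2, h4]; ring
    · rw [← sub_eq_zero.1 h1, h4]; ring

/-- The roots of `P` are exactly the values `-χ₁² / 4` over all arrangements of the branch
points. -/
theorem isRoot_polyP_iff_exists_corresponds {lam : Fin 6 → ℂ} (hns : Function.Injective lam)
    (N : ℂ) : (polyP lam).IsRoot N ↔ ∃ z, Corresponds lam N z := by
  by_cases hN : N = 0
  · subst hN
    rw [isRoot_polyP_zero_iff]
    exact ⟨Elim.exists_corresponds_zero_of_discr_eq_zero hns,
      fun ⟨_, h⟩ => Elim.discr_eq_zero_of_corresponds_zero h⟩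
  · rw [isRoot_polyP_iff_of_ne_zero lam hN]
    exact ⟨fun ⟨_, h3, h4⟩ => Elim.exists_corresponds_of_evalEval_eq_zero hns hN h3 h4,
      fun ⟨z, h⟩ => ⟨z, Elim.evalEval_H3_eq_zero_of_corresponds h⟩⟩

/-! ### Arrangements of three conjugate pairs -/

/-- An arrangement of the branch points is encoded by a balanced choice of signs. -/
theorem exists_signs_of_perm (lam : Fin 6 → ℂ) (π : Equiv.Perm (Fin 6)) :
    ∃ e : Fin 6 → ℝ, (∀ i, e i = 1 ∨ e i = -1) ∧ ∑ i, e i = 0 ∧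
      chi1 lam π = ∑ i, (e i : ℂ) * lam i ∧ chi2 lam π = ∑ i, (e i : ℂ) * lam i ^ 2 := by
  refine ⟨fun i => if (π.symm i).val < 3 then 1 else -1, fun i => ?_, ?_, ?_, ?_⟩
  · dsimp only
    split_ifs <;> simp
  · rw [← Equiv.sum_comp π]
    simp [Fin.sum_univ_six]
  · rw [← Equiv.sum_comp π, Fin.sum_univ_six, chi1]
    simp
    ring
  · rw [← Equiv.sum_comp π, Fin.sum_univ_six, chi2]
    simp
    ring

/-- The reality conditions for an arrangement of three conjugate pairs that keeps together the
pairs `rj ± i sj` and `rk ± i sk`, and separates the third one. -/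
theorem mixed_arrangement {rj rk rb sj sk sb y : ℝ} (hj : 0 < sj) (hk : 0 < sk) (hb : 0 < sb)
    (h : (rj - rk) * sb = 0)
    (hy : y = 2 * (sb * (rj ^ 2 - sj ^ 2 - rk ^ 2 + sk ^ 2) + 2 * (rj - rk) * rb * sb) ∨
      y = -2 * (sb * (rj ^ 2 - sj ^ 2 - rk ^ 2 + sk ^ 2) + 2 * (rj - rk) * rb * sb)) :
    rj = rk ∧ (y = 0 → sj = sk) := by
  obtain rfl : rj = rk := sub_eq_zero.1 ((mul_eq_zero.1 h).resolve_right hb.ne')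
  -- With equal real parts, `y` reduces to ±2 sb (sk² - sj²).
  refine ⟨rfl, fun h0 => (mul_self_inj hj.le hk.le).1 ?_⟩
  apply mul_left_cancel₀ hb.ne'
  rcases hy with hy | hy <;> linarith

set_option maxHeartbeats 1000000 in
/-- For conjugate pairs of branch points, a real `ν₁` either is one of the four values, or comes
from an arrangement that keeps one conjugate pair together; then two pairs have the same real
part. -/
theorem corresponds_cases {lam : Fin 6 → ℂ} {r s : Fin 3 → ℝ} (h : AreConjugatePairs lam r s)
    {x : ℝ} {z : ℂ} (hc : Corresponds lam (x : ℂ) z) :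
    (∃ i : Fin 4, x = nu1Root s i ∧ z = (nu2Root r s i : ℂ)) ∨
      ∃ j k : Fin 3, j ≠ k ∧ r j = r k ∧ (z.im = 0 → s j = s k) := by
  obtain ⟨h0, h1, h2, σ, p0, p1, p2, p3, p4, p5⟩ := h
  obtain ⟨π, hx, hz⟩ := hc
  obtain ⟨e, he, hsum, c1, c2⟩ := exists_signs_of_perm lam π
  rw [← Equiv.sum_comp σ, Fin.sum_univ_six] at hsum c1 c2
  rw [p0, p1, p2, p3, p4, p5] at c1 c2
  rw [c1] at hx hz
  rw [c2] at hz
  have s1 : 0 < s 1 := h0.trans_le h1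
  have s2 : 0 < s 2 := s1.trans_le h2
  have hxre := congrArg Complex.re hx
  have hxim := congrArg Complex.im hx
  have hzre := congrArg Complex.re hz
  have hzim := congrArg Complex.im hz
  simp [pow_two] at hxre hxim hzre hzim
  have e0 := he (σ 0)
  have e1 := he (σ 1)
  have e2 := he (σ 2)
  have e3 := he (σ 3)
  have e4 := he (σ 4)
  have e5 := he (σ 5)
  generalize e (σ 0) = a0 at *
  generalize e (σ 1) = a1 at *
  generalize e (σ 2) = a2 at *
  generalize e (σ 3) = a3 at *
  generalize e (σ 4) = a4 at *
  generalize e (σ 5) = a5 at *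
  clear he c1 c2 hx hz p0 p1 p2 p3 p4 p5
  -- Of the 64 sign patterns, 20 are balanced. Eight of these separate every pair and give the left
  -- alternative; the other twelve keep one pair with sign +, one with sign -, and give the right
  -- one.
  rcases e0 with rfl | rfl <;> rcases e1 with rfl | rfl <;> rcases e2 with rfl | rfl <;>
    rcases e3 with rfl | rfl <;> rcases e4 with rfl | rfl <;> rcases e5 with rfl | rfl <;>
    first
    | (exfalso; norm_num at hsum; done)
    | (left
       first
       | refine ⟨0, ?_, Complex.ext ?_ ?_⟩ <;> simp [nu1Root, nu2Root] <;>
          first | linear_combination hxre | linear_combination hzre | linear_combination hzim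
       | refine ⟨1, ?_, Complex.ext ?_ ?_⟩ <;> simp [nu1Root, nu2Root] <;>
          first | linear_combination hxre | linear_combination hzre | linear_combination hzim
       | refine ⟨2, ?_, Complex.ext ?_ ?_⟩ <;> simp [nu1Root, nu2Root] <;>
          first | linear_combination hxre | linear_combination hzre | linear_combination hzim
       | refine ⟨3, ?_, Complex.ext ?_ ?_⟩ <;> simp [nu1Root, nu2Root] <;>
          first | linear_combination hxre | linear_combination hzre | linear_combination hzim)
    | (right
       first
       | refine ⟨0, 1, by decide, mixed_arrangement (rb := r 2) h0 s1 s2 ?_ ?_⟩ <;>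
          first
          | linear_combination hxim / 8
          | linear_combination -hxim / 8
          | (left; linear_combination hzim)
          | (right; linear_combination hzim)
       | refine ⟨0, 2, by decide, mixed_arrangement (rb := r 1) h0 s2 s1 ?_ ?_⟩ <;>
          first
          | linear_combination hxim / 8
          | linear_combination -hxim / 8
          | (left; linear_combination hzim)
          | (right; linear_combination hzim)
       | refine ⟨1, 2, by decide, mixed_arrangement (rb := r 0) s1 s2 h0 ?_ ?_⟩ <;>
          first
          | linear_combination hxim / 8
          | linear_combination -hxim / 8
          | (left; linear_combination hzim)
          | (right; linear_combination hzim))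

theorem corresponds_of_comp {lam : Fin 6 → ℂ} (σ : Equiv.Perm (Fin 6)) {x z : ℂ}
    (h : Corresponds (lam ∘ σ) x z) : Corresponds lam x z := by
  obtain ⟨π, hx, hz⟩ := h
  exact ⟨π.trans σ, hx, hz⟩

/-- Each of the four pairs comes from an arrangement that separates every conjugate pair. -/
theorem corresponds_nuRoot {lam : Fin 6 → ℂ} {r s : Fin 3 → ℝ} (h : AreConjugatePairs lam r s)
    (i : Fin 4) : Corresponds lam (nu1Root s i : ℂ) (nu2Root r s i : ℂ) := by
  obtain ⟨-, -, -, σ, p0, p1, p2, p3, p4, p5⟩ := h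
  apply corresponds_of_comp σ
  have key : ∀ f : Fin 6 → Fin 6, Function.Bijective f → ∀ x z : ℂ,
      x = -(1 / 4) * (lam (σ (f 0)) + lam (σ (f 1)) + lam (σ (f 2)) - lam (σ (f 3))
        - lam (σ (f 4)) - lam (σ (f 5))) ^ 2 →
      z = -(1 / 2) * (lam (σ (f 0)) + lam (σ (f 1)) + lam (σ (f 2)) - lam (σ (f 3))
        - lam (σ (f 4)) - lam (σ (f 5))) *
        (lam (σ (f 0)) ^ 2 + lam (σ (f 1)) ^ 2 + lam (σ (f 2)) ^ 2 - lam (σ (f 3)) ^ 2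
        - lam (σ (f 4)) ^ 2 - lam (σ (f 5)) ^ 2) → Corresponds (lam ∘ σ) x z :=
    fun f hf x z hx hz => ⟨Equiv.ofBijective f hf, hx, hz⟩
  fin_cases i
  -- Even indices are the roots r + is, odd ones their conjugates; the first three entries thus
  -- encode the signs of s₀, s₁, s₂ in the bracket.
  · refine key ![0, 2, 5, 1, 3, 4] (by decide) _ _ ?_ ?_
    · simp [nu1Root, p0, p1, p2, p3, p4, p5]
      linear_combination ((s 0 : ℂ) + s 1 - s 2) ^ 2 * Complex.I_sq
    · simp [nu2Root, p0, p1, p2, p3, p4, p5]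
      linear_combination
        4 * ((s 0 : ℂ) + s 1 - s 2) * (r 0 * s 0 + r 1 * s 1 - r 2 * s 2) * Complex.I_sq
  · refine key ![0, 3, 4, 1, 2, 5] (by decide) _ _ ?_ ?_
    · simp [nu1Root, p0, p1, p2, p3, p4, p5]
      linear_combination ((s 0 : ℂ) - s 1 + s 2) ^ 2 * Complex.I_sq
    · simp [nu2Root, p0, p1, p2, p3, p4, p5]
      linear_combination
        4 * ((s 0 : ℂ) - s 1 + s 2) * (r 0 * s 0 - r 1 * s 1 + r 2 * s 2) * Complex.I_sq
  · refine key ![1, 2, 4, 0, 3, 5] (by decide) _ _ ?_ ?_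
    · simp [nu1Root, p0, p1, p2, p3, p4, p5]
      linear_combination (-(s 0 : ℂ) + s 1 + s 2) ^ 2 * Complex.I_sq
    · simp [nu2Root, p0, p1, p2, p3, p4, p5]
      linear_combination
        4 * (-(s 0 : ℂ) + s 1 + s 2) * (-(r 0 * s 0) + r 1 * s 1 + r 2 * s 2) * Complex.I_sq
  · refine key ![0, 2, 4, 1, 3, 5] (by decide) _ _ ?_ ?_
    · simp [nu1Root, p0, p1, p2, p3, p4, p5]
      linear_combination ((s 0 : ℂ) + s 1 + s 2) ^ 2 * Complex.I_sq
    · simp [nu2Root, p0, p1, p2, p3, p4, p5]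
      linear_combination
        4 * ((s 0 : ℂ) + s 1 + s 2) * (r 0 * s 0 + r 1 * s 1 + r 2 * s 2) * Complex.I_sq

/-! ### The four real pairs: completeness, order and distinctness -/

/-- Distinct branch points give distinct pairs. -/
theorem AreConjugatePairs.eq_of_eq {lam : Fin 6 → ℂ} {r s : Fin 3 → ℝ}
    (h : AreConjugatePairs lam r s) (hns : Function.Injective lam) {j k : Fin 3}
    (hr : r j = r k) (hs : s j = s k) : j = k := by
  obtain ⟨-, -, -, σ, p0, -, p2, -, p4, -⟩ := h
  have hinj : Function.Injective (lam ∘ σ) := hns.comp σ.injective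
  have hf : ∀ j : Fin 3, (lam ∘ σ) (![0, 2, 4] j) = r j + Complex.I * s j := fun j => by
    fin_cases j <;> simp [p0, p2, p4]
  have h1 : (lam ∘ σ) (![0, 2, 4] j) = (lam ∘ σ) (![0, 2, 4] k) := by rw [hf, hf, hr, hs]
  have h2 : (![0, 2, 4] : Fin 3 → Fin 6) j = ![0, 2, 4] k := hinj h1
  have h3 : Function.Injective (![0, 2, 4] : Fin 3 → Fin 6) := by decide
  exact h3 h2

/-- A corresponding pair of real numbers is one of the four pairs. -/
theorem exists_nuRoot_of_corresponds_real {lam : Fin 6 → ℂ} (hns : Function.Injective lam)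
    {r s : Fin 3 → ℝ} (h : AreConjugatePairs lam r s) {x y : ℝ}
    (hc : Corresponds lam (x : ℂ) (y : ℂ)) :
    ∃ i : Fin 4, x = nu1Root s i ∧ y = nu2Root r s i := by
  rcases corresponds_cases h hc with ⟨i, hx, hy⟩ | ⟨j, k, hjk, hr, hs⟩
  · exact ⟨i, hx, by exact_mod_cast hy⟩
  · exact absurd (h.eq_of_eq hns hr (hs (Complex.ofReal_im y))) hjk

theorem exists_nuRoot_of_corresponds_of_injective {lam : Fin 6 → ℂ} {r s : Fin 3 → ℝ}
    (h : AreConjugatePairs lam r s) (hr : Function.Injective r) {x : ℝ} {z : ℂ}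
    (hc : Corresponds lam (x : ℂ) z) :
    ∃ i : Fin 4, x = nu1Root s i ∧ z = (nu2Root r s i : ℂ) := by
  rcases corresponds_cases h hc with h | ⟨j, k, hjk, hr', -⟩
  · exact h
  · exact absurd (hr hr') hjk

/-- Consecutive differences factor as 4s₀(s₂ - s₁), 4s₂(s₁ - s₀) and 4s₀(s₁ + s₂). -/
theorem nu1Root_order {s : Fin 3 → ℝ} (h0 : 0 < s 0) (h1 : s 0 ≤ s 1) (h2 : s 1 ≤ s 2) :
    0 ≤ nu1Root s 0 ∧ nu1Root s 0 ≤ nu1Root s 1 ∧ nu1Root s 1 ≤ nu1Root s 2 ∧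
        nu1Root s 2 < nu1Root s 3 ∧
        (s 1 < s 2 → nu1Root s 0 < nu1Root s 1) ∧ (s 0 < s 1 → nu1Root s 1 < nu1Root s 2) := by
  simp only [nu1Root, Matrix.cons_val]
  refine ⟨sq_nonneg _, ?_, ?_, ?_, fun h => ?_, fun h => ?_⟩
  · nlinarith [mul_nonneg h0.le (sub_nonneg.2 h2)]
  · nlinarith [mul_nonneg (h0.le.trans (h1.trans h2)) (sub_nonneg.2 h1)]
  · nlinarith [mul_pos h0 (h0.trans_le h1), mul_pos h0 (h0.trans_le (h1.trans h2))]
  · nlinarith [mul_pos h0 (sub_pos.2 h)]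
  · nlinarith [mul_pos (h0.trans_le (h1.trans h2)) (sub_pos.2 h)]

/-- A coincidence among the first three ν₁ forces two of the s to agree. The difference of the ν₂ is
then a positive multiple of the difference of the matching r, so a full coincidence would make two
branch points equal; the fourth ν₁ is strictly largest. -/
theorem injective_nuRoot {lam : Fin 6 → ℂ} (hns : Function.Injective lam)
    {r s : Fin 3 → ℝ} (h : AreConjugatePairs lam r s) :
    Function.Injective (fun i : Fin 4 => (nu1Root s i, nu2Root r s i)) := by
  have h0 := h.1
  have h1 := h.2.1
  have h2 := h.2.2.1
  obtain ⟨-, o1, o2, o3, o4, o5⟩ := nu1Root_order h0 h1 h2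
  have n01 : ¬ (nu1Root s 0 = nu1Root s 1 ∧ nu2Root r s 0 = nu2Root r s 1) := fun ⟨e1, e2⟩ => by
    have hs : s 1 = s 2 := h2.eq_of_not_lt fun hlt => (o4 hlt).ne e1
    simp only [nu2Root, Matrix.cons_val, ← hs] at e2
    have hr : r 1 = r 2 := by
      have : (r 1 - r 2) * (8 * s 0 * s 1) = 0 := by linear_combination e2
      exact sub_eq_zero.1 ((mul_eq_zero.1 this).resolve_right
        (mul_pos (mul_pos (by norm_num) h0) (h0.trans_le h1)).ne')
    exact absurd (h.eq_of_eq hns hr hs) (by decide)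
  have n12 : ¬ (nu1Root s 1 = nu1Root s 2 ∧ nu2Root r s 1 = nu2Root r s 2) := fun ⟨e1, e2⟩ => by
    have hs : s 0 = s 1 := h1.eq_of_not_lt fun hlt => (o5 hlt).ne e1
    simp only [nu2Root, Matrix.cons_val, ← hs] at e2
    have hr : r 0 = r 1 := by
      have : (r 0 - r 1) * (8 * s 0 * s 2) = 0 := by linear_combination e2
      exact sub_eq_zero.1 ((mul_eq_zero.1 this).resolve_right
        (mul_pos (mul_pos (by norm_num) h0) (h0.trans_le (h1.trans h2))).ne')
    exact absurd (h.eq_of_eq hns hr hs) (by decide)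
  have n02 : ¬ (nu1Root s 0 = nu1Root s 2 ∧ nu2Root r s 0 = nu2Root r s 2) := fun ⟨e1, e2⟩ => by
    have hs : s 1 = s 2 := h2.eq_of_not_lt fun hlt => ((o4 hlt).trans_le o2).ne e1
    have hs' : s 0 = s 1 := h1.eq_of_not_lt fun hlt => (o1.trans_lt (o5 hlt)).ne e1
    simp only [nu2Root, Matrix.cons_val, ← hs, ← hs'] at e2
    have hr : r 0 = r 2 := by
      have : (r 0 - r 2) * (8 * s 0 * s 0) = 0 := by linear_combination e2
      exact sub_eq_zero.1 ((mul_eq_zero.1 this).resolve_right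
        (mul_pos (mul_pos (by norm_num) h0) h0).ne')
    exact absurd (h.eq_of_eq hns hr (hs'.trans hs)) (by decide)
  have n3 : ∀ i : Fin 4, i ≠ 3 → nu1Root s i ≠ nu1Root s 3 := fun i hi => by
    fin_cases i
    · exact ((o1.trans o2).trans_lt o3).ne
    · exact (o2.trans_lt o3).ne
    · exact o3.ne
    · exact absurd rfl hi
  intro i j hij
  have hij1 : nu1Root s i = nu1Root s j := congrArg Prod.fst hij
  have hij2 : nu2Root r s i = nu2Root r s j := congrArg Prod.snd hij
  by_cases hi : i = 3
  · subst hi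
    by_contra hj
    exact n3 j (Ne.symm hj) hij1.symm
  by_cases hj : j = 3
  · subst hj
    exact absurd hij1 (n3 i hi)
  fin_cases i <;> fin_cases j <;> first
    | rfl
    | exact absurd rfl hi
    | exact absurd rfl hj
    | exact (n01 (And.intro hij1 hij2)).elim
    | exact (n01 (And.intro hij1.symm hij2.symm)).elim
    | exact (n12 (And.intro hij1 hij2)).elim
    | exact (n12 (And.intro hij1.symm hij2.symm)).elim
    | exact (n02 (And.intro hij1 hij2)).elim
    | exact (n02 (And.intro hij1.symm hij2.symm)).elim

theorem setOf_real_pairs_eq_range {lam : Fin 6 → ℂ} (hns : Function.Injective lam)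
    {r s : Fin 3 → ℝ} (h : AreConjugatePairs lam r s) :
    {q : ℝ × ℝ | (polyP lam).IsRoot (q.1 : ℂ) ∧ Corresponds lam (q.1 : ℂ) (q.2 : ℂ)}
      = Set.range (fun i : Fin 4 => (nu1Root s i, nu2Root r s i)) := by
  ext ⟨x, y⟩
  constructor
  · rintro ⟨-, hc⟩
    obtain ⟨i, hx, hy⟩ := exists_nuRoot_of_corresponds_real hns h hc
    exact ⟨i, Prod.ext hx.symm hy.symm⟩
  · rintro ⟨i, hi⟩
    obtain ⟨rfl, rfl⟩ := Prod.mk.inj hi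
    exact ⟨(isRoot_polyP_iff_exists_corresponds hns _).2 ⟨_, corresponds_nuRoot h i⟩,
      corresponds_nuRoot h i⟩

theorem isRoot_real_iff_of_injective {lam : Fin 6 → ℂ} (hns : Function.Injective lam)
    {r s : Fin 3 → ℝ} (h : AreConjugatePairs lam r s) (hr : Function.Injective r) (x : ℝ) :
    (polyP lam).IsRoot (x : ℂ) ↔ x ∈ Set.range (nu1Root s) := by
  rw [isRoot_polyP_iff_exists_corresponds hns]
  constructor
  · rintro ⟨z, hc⟩
    obtain ⟨i, hx, -⟩ := exists_nuRoot_of_corresponds_of_injective h hr hc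
    exact ⟨i, hx.symm⟩
  · rintro ⟨i, rfl⟩
    exact ⟨_, corresponds_nuRoot h i⟩

/-! ### The spectral curve in terms of the jet `(p, p', p'')` -/

/-- The entry `Ψ₁₁` as a function of the jet of the solution. -/
noncomputable def jet11 (c : Fin 3 → ℝ) (l : ℂ) (j : ℂ × ℂ × ℂ) : ℂ :=
  -Complex.I * l ^ 3 - Complex.I * c 2 * l ^ 2
    + (1 / 2 * Complex.I * (‖j.1‖ : ℂ) ^ 2 - Complex.I * c 1) * l
    + 1 / 4 * (j.1 * star j.2.1 - j.2.1 * star j.1)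
    + 1 / 2 * Complex.I * c 2 * (‖j.1‖ : ℂ) ^ 2 - Complex.I * c 0

/-- The entry `Ψ₁₂` as a function of the jet of the solution. -/
noncomputable def jet12 (c : Fin 3 → ℝ) (l : ℂ) (j : ℂ × ℂ × ℂ) : ℂ :=
  Complex.I * j.1 * l ^ 2
    + (-(1 / 2) * j.2.1 + Complex.I * c 2 * j.1) * l
    - 1 / 4 * Complex.I * j.2.2
    - 1 / 2 * Complex.I * j.1 * (‖j.1‖ : ℂ) ^ 2
    - 1 / 2 * c 2 * j.2.1 + Complex.I * c 1 * j.1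

/-- The entry `Ψ₂₁` as a function of the jet of the solution. -/
noncomputable def jet21 (c : Fin 3 → ℝ) (l : ℂ) (j : ℂ × ℂ × ℂ) : ℂ :=
  Complex.I * star j.1 * l ^ 2
    + (1 / 2 * star j.2.1 + Complex.I * c 2 * star j.1) * l
    - 1 / 4 * Complex.I * star j.2.2
    - 1 / 2 * Complex.I * star j.1 * (‖j.1‖ : ℂ) ^ 2
    + 1 / 2 * c 2 * star j.2.1 + Complex.I * c 1 * star j.1

/-- The jet `(p, p', p'')` of `p` at `(x, t)`. -/
noncomputable def jet (p : ℝ → ℝ → ℂ) (x t : ℝ) : ℂ × ℂ × ℂ := (p x t, dx p x t, dx (dx p) x t)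

/-- The polynomial `𝓡` as a function of the jet. -/
noncomputable def jetR (c : Fin 3 → ℝ) (l : ℂ) (j : ℂ × ℂ × ℂ) : ℂ :=
  -jet11 c l j ^ 2 - jet12 c l j * jet21 c l j

theorem continuous_jetR (c : Fin 3 → ℝ) (l : ℂ) : Continuous (jetR c l) := by
  unfold jetR jet11 jet12 jet21
  fun_prop

theorem norm_sq_eq_mul_star (a : ℂ) : (‖a‖ : ℂ) ^ 2 = a * star a :=
  (Complex.mul_conj' a).symm

/-- If the logarithmic derivatives `p' / p` and `p'' / p` are imaginary and real respectively, then
`𝓡` is a sum of two squares and `(ν₁, ν₂)` comes from an arrangement of the branch points. -/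
theorem corresponds_of_jet {c : Fin 3 → ℝ} {lam : Fin 6 → ℂ} (hns : Function.Injective lam)
    {j : ℂ × ℂ × ℂ} (hR : ∀ l, jetR c l j = ∏ i, (l - lam i)) (h0 : j.1 ≠ 0)
    (h1 : star j.1 * j.2.1 + j.1 * star j.2.1 = 0) (h2 : star j.1 * j.2.2 = j.1 * star j.2.2) :
    Corresponds lam ((‖j.1‖ : ℂ) ^ 2)
      (Complex.I * (star j.1 * j.2.1 - j.1 * star j.2.1)) := by
  obtain ⟨a, b, d⟩ := j
  simp only [jetR, jet11, jet12, jet21] at *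
  have hN := norm_sq_eq_mul_star a
  have hs0 : star a ≠ 0 := star_ne_zero.2 h0
  obtain ⟨β, rfl⟩ : ∃ β, b = β * a := ⟨b / a, (div_mul_cancel₀ b h0).symm⟩
  obtain ⟨δ, rfl⟩ : ∃ δ, d = δ * a := ⟨d / a, (div_mul_cancel₀ d h0).symm⟩
  have hβ : star (β * a) = -β * star a := by
    apply mul_left_cancel₀ h0; linear_combination h1
  have hδ : star (δ * a) = δ * star a := by
    apply mul_left_cancel₀ h0; linear_combination -h2
  rw [hβ] at hR ⊢
  rw [hδ] at hR
  generalize star a = a' at *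
  generalize (‖a‖ : ℂ) = n at *
  have h := corresponds_of_sq_add_sq hns (a₂ := c 2) (a₁ := c 1 - n ^ 2 / 2)
    (a₀ := Complex.I / 4 * (a * (-β * a') - β * a * a') - 1 / 2 * c 2 * n ^ 2 + c 0)
    (n := n) (b₁ := n * (c 2 + Complex.I / 2 * β))
    (b₀ := n * (-1 / 4 * δ - 1 / 2 * n ^ 2 + Complex.I / 2 * c 2 * β + c 1)) (fun l => by
      rw [← hR l]
      have hI : Complex.I ^ 2 = -1 := Complex.I_sq
      generalize Complex.I = I at *
      -- The two hypotheses on the jet make both off-diagonal entries multiples of one quadratic q: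
      -- they are iaq and ia'q, while the diagonal entry is -iA. Hence 𝓡 = A² + n²q².
      obtain ⟨q, hq⟩ : ∃ q, q = l ^ 2 + (c 2 + I / 2 * β) * l
        + (-1 / 4 * δ - 1 / 2 * n ^ 2 + I / 2 * c 2 * β + c 1) := ⟨_, rfl⟩
      obtain ⟨A, hA⟩ : ∃ A, A = l ^ 3 + c 2 * l ^ 2 + (c 1 - n ^ 2 / 2) * l
        + (I / 4 * (a * (-β * a') - β * a * a') - 1 / 2 * c 2 * n ^ 2 + c 0) := ⟨_, rfl⟩
      have e11 : -I * l ^ 3 - I * c 2 * l ^ 2 + (1 / 2 * I * n ^ 2 - I * c 1) * l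
          + 1 / 4 * (a * (-β * a') - β * a * a') + 1 / 2 * I * c 2 * n ^ 2 - I * c 0
          = -I * A := by
        rw [hA]; linear_combination (1 / 4 * (a * (-β * a') - β * a * a')) * hI
      have e12 : I * a * l ^ 2 + (-(1 / 2) * (β * a) + I * c 2 * a) * l - 1 / 4 * I * (δ * a)
          - 1 / 2 * I * a * n ^ 2 - 1 / 2 * c 2 * (β * a) + I * c 1 * a = I * a * q := by
        rw [hq]; linear_combination (-(1 / 2) * a * β * (l + c 2)) * hI
      have e21 : I * a' * l ^ 2 + (1 / 2 * (-β * a') + I * c 2 * a') * l - 1 / 4 * I * (δ * a')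
          - 1 / 2 * I * a' * n ^ 2 + 1 / 2 * c 2 * (-β * a') + I * c 1 * a' = I * a' * q := by
        rw [hq]; linear_combination (-(1 / 2) * a' * β * (l + c 2)) * hI
      have eB : n * l ^ 2 + n * (c 2 + I / 2 * β) * l
          + n * (-1 / 4 * δ - 1 / 2 * n ^ 2 + I / 2 * c 2 * β + c 1) = n * q := by
        rw [hq]; ring
      rw [e11, e12, e21, eB, ← hA]
      linear_combination (-A ^ 2 - a * a' * q ^ 2) * hI - q ^ 2 * hN)
  convert h using 1
  linear_combination (-2 * Complex.I * β) * hN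

/-! ### Derivatives of the jet -/

/-- The `t`-derivative of `Ψ₁₂` prescribed by the Lax equation, as a function of the jet. -/
noncomputable def jet12t (c : Fin 3 → ℝ) (l : ℂ) (j : ℂ × ℂ × ℂ) : ℂ :=
  2 * (-2 * Complex.I * l ^ 2 + Complex.I * (‖j.1‖ : ℂ) ^ 2) * jet12 c l j
    - 2 * (2 * Complex.I * l * j.1 - j.2.1) * jet11 c l j

theorem continuous_jet12t (c : Fin 3 → ℝ) (l : ℂ) : Continuous (jet12t c l) := by
  unfold jet12t jet11 jet12
  fun_prop

namespace IsSmoothTwoPhaseSolution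

variable {p : ℝ → ℝ → ℂ} {c : Fin 3 → ℝ}

theorem hasDerivAt_psi12_t (hp : IsSmoothTwoPhaseSolution p c) (l : ℂ) (x t : ℝ) :
    HasDerivAt (fun u => jet12 c l (jet p x u)) (jet12t c l (jet p x t)) t := by
  have h := hp.stationary_t l x t 0 1
  simp [psi, laxV] at h
  have hj : jet12t c l (jet p x t)
      = 2 * (-2 * Complex.I * l ^ 2 + Complex.I * (‖p x t‖ : ℂ) ^ 2) * psi12 p c l x t
        - 2 * (2 * Complex.I * l * p x t - dx p x t) * psi11 p c l x t := rfl
  rw [hj]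
  change HasDerivAt (fun u => psi12 p c l x u) _ t
  convert h using 1
  ring

/-- The polynomial `𝓡` does not depend on `x`. -/
theorem jetR_const_x (hp : IsSmoothTwoPhaseSolution p c) (l : ℂ) (x x' t : ℝ) :
    jetR c l (jet p x t) = jetR c l (jet p x' t) := by
  -- 𝓡 is the determinant of Ψ, and a commutator flow preserves it.
  have hd : ∀ y, HasDerivAt (fun y => jetR c l (jet p y t)) 0 y := fun y => by
    have h0 := hp.stationary_x l y t 0 0
    have h1 := hp.stationary_x l y t 0 1
    have h2 := hp.stationary_x l y t 1 0
    simp [psi, laxU] at h0 h1 h2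
    convert! ((h0.pow 2).neg).sub (h1.mul h2) using 1
    simp
    ring
  exact is_const_of_deriv_eq_zero (fun y => (hd y).differentiableAt) (fun y => (hd y).deriv) x x'

/-- The polynomial `𝓡` does not depend on `t`. -/
theorem jetR_const_t (hp : IsSmoothTwoPhaseSolution p c) (l : ℂ) (x t t' : ℝ) :
    jetR c l (jet p x t) = jetR c l (jet p x t') := by
  have hd : ∀ u, HasDerivAt (fun u => jetR c l (jet p x u)) 0 u := fun u => by
    have h0 := hp.stationary_t l x u 0 0
    have h1 := hp.stationary_t l x u 0 1
    have h2 := hp.stationary_t l x u 1 0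
    simp [psi, laxV] at h0 h1 h2
    convert! ((h0.pow 2).neg).sub (h1.mul h2) using 1
    simp
    ring
  exact is_const_of_deriv_eq_zero (fun y => (hd y).differentiableAt) (fun y => (hd y).deriv) t t'

theorem jetR_eq (hp : IsSmoothTwoPhaseSolution p c) {lam : Fin 6 → ℂ}
    (hlam : IsBranchPoints p c lam) (l : ℂ) (x t : ℝ) :
    jetR c l (jet p x t) = ∏ i, (l - lam i) := by
  obtain ⟨x', t', h⟩ := hlam
  rw [hp.jetR_const_x l x x' t, hp.jetR_const_t l x' t t', ← h l]
  rfl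

theorem hasDerivAt_x (hp : IsSmoothTwoPhaseSolution p c) (x t : ℝ) :
    HasDerivAt (fun y => p y t) (dx p x t) x := by
  have h : ContDiff ℝ ∞ (fun y => p y t) := hp.smooth.comp (contDiff_id.prodMk contDiff_const)
  exact (h.differentiable (by simp) x).hasDerivAt

theorem hasDerivAt_dx_x (hp : IsSmoothTwoPhaseSolution p c) (x t : ℝ) :
    HasDerivAt (fun y => dx p y t) (dx (dx p) x t) x := by
  have h : ContDiff ℝ ∞ (fun y => p y t) := hp.smooth.comp (contDiff_id.prodMk contDiff_const)
  have h2 : ContDiff ℝ ∞ (deriv fun y => p y t) := (contDiff_infty_iff_deriv.1 h).2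
  exact (h2.differentiable (by simp) x).hasDerivAt

theorem hasDerivAt_t (hp : IsSmoothTwoPhaseSolution p c) (x t : ℝ) :
    HasDerivAt (fun u => p x u)
      (Complex.I * (dx (dx p) x t + 2 * (‖p x t‖ : ℂ) ^ 2 * p x t)) t := by
  have h : ContDiff ℝ ∞ (fun u => p x u) := hp.smooth.comp (contDiff_const.prodMk contDiff_id)
  have h1 : HasDerivAt (fun u => p x u) (dt p x t) t := (h.differentiable (by simp) t).hasDerivAt
  convert h1 using 1
  linear_combination Complex.I * hp.nls x t - dt p x t * Complex.I_sq

/-- The second derivative `p''` has a `t`-derivative that is a continuous function of the jet. -/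
theorem exists_hasDerivAt_dx_dx_t (hp : IsSmoothTwoPhaseSolution p c) :
    ∃ F : ℂ × ℂ × ℂ → ℂ, Continuous F ∧
      ∀ x t, HasDerivAt (fun u => dx (dx p) x u) (F (jet p x t)) t := by
  let F₀ : ℂ × ℂ × ℂ → ℂ := fun j => Complex.I * (j.2.2 + 2 * (‖j.1‖ : ℂ) ^ 2 * j.1)
  have hF₀ : Continuous F₀ := by fun_prop
  have h₀ : ∀ x t, HasDerivAt (fun u => p x u) (F₀ (jet p x t)) t := hp.hasDerivAt_t
  -- Ψ₁₂(1) - Ψ₁₂(-1) = -p' + 2ic₂p, so the Lax equation supplies the t-derivative of p' with no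
  -- exchange of partial derivatives; Ψ₁₂(0) does the same for p'' below.
  let F₁ : ℂ × ℂ × ℂ → ℂ := fun j =>
    -(jet12t c 1 j - jet12t c (-1) j) + 2 * Complex.I * c 2 * F₀ j
  have hF₁ : Continuous F₁ := by
    have := continuous_jet12t c 1
    have := continuous_jet12t c (-1)
    fun_prop
  have h₁ : ∀ x t, HasDerivAt (fun u => dx p x u) (F₁ (jet p x t)) t := fun x t => by
    convert! ((hp.hasDerivAt_psi12_t 1 x t).sub (hp.hasDerivAt_psi12_t (-1) x t)).neg.add
      ((h₀ x t).const_mul (2 * Complex.I * c 2)) using 1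
    funext u
    simp [jet12, jet]
    ring
  let F₂ : ℂ × ℂ × ℂ → ℂ := fun j =>
    4 * Complex.I * (jet12t c 0 j + 1 / 2 * Complex.I * (F₀ j * (j.1 * star j.1)
      + j.1 * (F₀ j * star j.1 + j.1 * star (F₀ j))) + 1 / 2 * c 2 * F₁ j - Complex.I * c 1 * F₀ j)
  have hF₂ : Continuous F₂ := by
    have := continuous_jet12t c 0
    fun_prop
  refine ⟨F₂, hF₂, fun x t => ?_⟩
  convert! ((((hp.hasDerivAt_psi12_t 0 x t).add
    (((h₀ x t).mul ((h₀ x t).mul (h₀ x t).star)).const_mul (1 / 2 * Complex.I))).add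
    ((h₁ x t).const_mul (1 / 2 * (c 2 : ℂ)))).sub
    ((h₀ x t).const_mul (Complex.I * c 1))).const_mul (4 * Complex.I) using 1
  funext u
  simp only [jet12, jet, Pi.add_apply, Pi.sub_apply, Pi.mul_apply, norm_sq_eq_mul_star]
  linear_combination dx (dx p) x u * Complex.I_sq

end IsSmoothTwoPhaseSolution

/-! ### A Landau-type inequality -/

/-- A one-sided bound of a function with bounded second derivative controls its first
derivative. -/
theorem sq_deriv_le_of_bound {g g' g'' : ℝ → ℝ} {C M : ℝ} (hC : 0 < C)
    (hg : ∀ y, HasDerivAt g (g' y) y) (hg' : ∀ y, HasDerivAt g' (g'' y) y)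
    (hb : ∀ y, |g'' y| ≤ C) (hM : ∀ y, g y ≤ M) (x : ℝ) : g' x ^ 2 ≤ 4 * C * (M - g x) := by
  -- This step length maximizes g'(x)h - Ch², a lower bound for g(x + h) - g(x); the maximum is
  -- g'(x)²/(4C).
  obtain ⟨h, hh⟩ : ∃ h, h = g' x / (2 * C) := ⟨_, rfl⟩
  have hx : x ∈ Metric.closedBall x |h| := Metric.mem_closedBall_self (abs_nonneg h)
  have hxh : x + h ∈ Metric.closedBall x |h| := by simp
  have h1 : ∀ y ∈ Metric.closedBall x |h|, ‖g' y - g' x‖ ≤ C * |h| := fun y hy => by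
    have := (convex_univ (𝕜 := ℝ) (E := ℝ)).norm_image_sub_le_of_norm_hasDerivWithin_le
      (fun z _ => (hg' z).hasDerivWithinAt) (fun z _ => hb z) (Set.mem_univ x) (Set.mem_univ y)
    exact this.trans (mul_le_mul_of_nonneg_left (by simpa [Real.dist_eq] using hy) hC.le)
  have h2 := (convex_closedBall x |h|).norm_image_sub_le_of_norm_hasDerivWithin_le
    (f := fun y => g y - g' x * y) (f' := fun y => g' y - g' x)
    (fun y _ => ((hg y).sub (by simpa using (hasDerivAt_id y).const_mul (g' x))).hasDerivWithinAt)
    h1 hx hxh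
  simp only [Real.norm_eq_abs, add_sub_cancel_left] at h2
  have h3 : g' x * h - C * h ^ 2 ≤ M - g x := by
    have h4 := (abs_le.1 h2).1
    have h5 : C * |h| * |h| = C * h ^ 2 := by rw [mul_assoc, abs_mul_abs_self, sq]
    rw [h5] at h4
    linarith [hM (x + h)]
  have h6 : g' x = 2 * C * h := by rw [hh]; field_simp
  have h7 : 4 * C * (g' x * h - C * h ^ 2) ≤ 4 * C * (M - g x) :=
    mul_le_mul_of_nonneg_left h3 (by positivity)
  refine le_trans (le_of_eq ?_) h7
  rw [h6]; ring

/-- The absolute value treats suprema and infima alike and gives a condition that is closed under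
limits. -/
theorem sq_deriv_le_of_bound_abs {g g' g'' : ℝ → ℝ} {C M : ℝ} (hC : 0 < C)
    (hg : ∀ y, HasDerivAt g (g' y) y) (hg' : ∀ y, HasDerivAt g' (g'' y) y)
    (hb : ∀ y, |g'' y| ≤ C) (hM : (∀ y, g y ≤ M) ∨ ∀ y, M ≤ g y) (x : ℝ) :
    g' x ^ 2 ≤ 4 * C * |M - g x| := by
  rcases hM with hM | hM
  · exact (sq_deriv_le_of_bound hC hg hg' hb hM x).trans
      (mul_le_mul_of_nonneg_left (le_abs_self _) (by positivity))
  · have h := sq_deriv_le_of_bound (M := -M) hC (fun y => (hg y).neg) (fun y => (hg' y).neg)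
      (fun y => by simpa using hb y) (fun y => neg_le_neg (hM y)) x
    simp only [Pi.neg_apply, neg_sq] at h
    refine h.trans (mul_le_mul_of_nonneg_left ?_ (by positivity))
    rw [abs_sub_comm]
    refine le_trans (le_of_eq ?_) (le_abs_self _)
    ring

/-! ### The derivatives of `|p|²` -/

/-- The `x`-derivative of `|p|²` as a function of the jet. -/
noncomputable def jetGx (j : ℂ × ℂ × ℂ) : ℝ := 2 * (star j.1 * j.2.1).re

/-- The `t`-derivative of `|p|²` as a function of the jet. -/
noncomputable def jetGt (j : ℂ × ℂ × ℂ) : ℝ := -2 * (star j.1 * j.2.2).im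

theorem continuous_jetGx : Continuous jetGx := by
  unfold jetGx; fun_prop

theorem continuous_jetGt : Continuous jetGt := by
  unfold jetGt; fun_prop

theorem HasDerivAt.complex_re {f : ℝ → ℂ} {f' : ℂ} {x : ℝ} (h : HasDerivAt f f' x) :
    HasDerivAt (fun y => (f y).re) f'.re x :=
  Complex.reCLM.hasFDerivAt.comp_hasDerivAt x h

theorem HasDerivAt.complex_im {f : ℝ → ℂ} {f' : ℂ} {x : ℝ} (h : HasDerivAt f f' x) :
    HasDerivAt (fun y => (f y).im) f'.im x :=
  Complex.imCLM.hasFDerivAt.comp_hasDerivAt x h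

theorem HasDerivAt.norm_sq_complex {f : ℝ → ℂ} {f' : ℂ} {x : ℝ} (h : HasDerivAt f f' x) :
    HasDerivAt (fun y => ‖f y‖ ^ 2) (2 * (star (f x) * f').re) x := by
  convert! (h.star.mul h).complex_re using 1
  · funext y
    simp [Complex.sq_norm, Complex.normSq_apply]
  · simp
    ring

namespace IsSmoothTwoPhaseSolution

variable {p : ℝ → ℝ → ℂ} {c : Fin 3 → ℝ}

theorem hasDerivAt_nu1_x (hp : IsSmoothTwoPhaseSolution p c) (x t : ℝ) :
    HasDerivAt (fun y => nu1 p y t) (jetGx (jet p x t)) x :=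
  (hp.hasDerivAt_x x t).norm_sq_complex

/-- By the NLS equation p*p_t = ip*p'' + 2i|p|⁴, and the last term has no real part. -/
theorem hasDerivAt_nu1_t (hp : IsSmoothTwoPhaseSolution p c) (x t : ℝ) :
    HasDerivAt (fun u => nu1 p x u) (jetGt (jet p x t)) t := by
  convert! (hp.hasDerivAt_t x t).norm_sq_complex using 1
  rw [show star (p x t) * (Complex.I * (dx (dx p) x t + 2 * (‖p x t‖ : ℂ) ^ 2 * p x t))
    = Complex.I * (star (p x t) * dx (dx p) x t) + Complex.I * ((2 * ‖p x t‖ ^ 4 : ℝ) : ℂ) by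
      push_cast
      linear_combination -2 * Complex.I * (‖p x t‖ : ℂ) ^ 2 * norm_sq_eq_mul_star (p x t)]
  simp only [jetGt, jet, Complex.add_re, Complex.I_mul_re, Complex.ofReal_im]
  ring

theorem exists_hasDerivAt_jetGx (hp : IsSmoothTwoPhaseSolution p c) :
    ∃ F : ℂ × ℂ × ℂ → ℝ, Continuous F ∧
      ∀ x t, HasDerivAt (fun y => jetGx (jet p y t)) (F (jet p x t)) x := by
  refine ⟨fun j => 2 * (star j.2.1 * j.2.1 + star j.1 * j.2.2).re, by fun_prop, fun x t => ?_⟩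
  exact (((hp.hasDerivAt_x x t).star.mul (hp.hasDerivAt_dx_x x t)).complex_re).const_mul 2

/-- Continuity in the jet is the point: on a bounded set of jets it bounds the second t-derivative
of |p|², as the Landau-type inequality requires. -/
theorem exists_hasDerivAt_jetGt (hp : IsSmoothTwoPhaseSolution p c) :
    ∃ F : ℂ × ℂ × ℂ → ℝ, Continuous F ∧
      ∀ x t, HasDerivAt (fun u => jetGt (jet p x u)) (F (jet p x t)) t := by
  obtain ⟨F, hF, h⟩ := hp.exists_hasDerivAt_dx_dx_t
  refine ⟨fun j => -2 * (star (Complex.I * (j.2.2 + 2 * (‖j.1‖ : ℂ) ^ 2 * j.1)) * j.2.2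
    + star j.1 * F j).im, by fun_prop, fun x t => ?_⟩
  exact (((hp.hasDerivAt_t x t).star.mul (h x t)).complex_im).const_mul (-2)

end IsSmoothTwoPhaseSolution

/-- Vanishing of Re(p*p') and Im(p*p'') is exactly what `corresponds_of_jet` asks of a jet. -/
theorem jetG_eq_zero_iff (j : ℂ × ℂ × ℂ) (hx : jetGx j = 0) (ht : jetGt j = 0) :
    star j.1 * j.2.1 + j.1 * star j.2.1 = 0 ∧ star j.1 * j.2.2 = j.1 * star j.2.2 := by
  obtain ⟨a, b, d⟩ := j
  simp [jetGx, jetGt] at hx ht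
  constructor
  · apply Complex.ext <;> simp
    · linarith
    · ring
  · apply Complex.ext
    · simp
    · simp
      linarith

/-- The value of `ν₂` is real. -/
theorem nu2_jet_real (j : ℂ × ℂ × ℂ) :
    Complex.I * (star j.1 * j.2.1 - j.1 * star j.2.1) = ((-2 * (star j.1 * j.2.1).im : ℝ) : ℂ) := by
  apply Complex.ext <;> simp <;> ring

/-- Together with the next two identities this is the symmetry Ψ(l*) = -Ψ(l)†, which relies on the
constants c being real. -/
theorem jet11_star (c : Fin 3 → ℝ) (l : ℂ) (j : ℂ × ℂ × ℂ) :
    jet11 c (star l) j = -star (jet11 c l j) := by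
  simp [jet11]
  ring

theorem jet12_star (c : Fin 3 → ℝ) (l : ℂ) (j : ℂ × ℂ × ℂ) :
    jet12 c (star l) j = -star (jet21 c l j) := by
  simp [jet12, jet21]
  ring

theorem jet21_star (c : Fin 3 → ℝ) (l : ℂ) (j : ℂ × ℂ × ℂ) :
    jet21 c (star l) j = -star (jet12 c l j) := by
  simp [jet12, jet21]
  ring

/-- The polynomial `𝓡` has real coefficients. -/
theorem jetR_star (c : Fin 3 → ℝ) (l : ℂ) (j : ℂ × ℂ × ℂ) :
    jetR c (star l) j = star (jetR c l j) := by
  rw [jetR, jetR, jet11_star, jet12_star, jet21_star]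
  simp
  ring

/-- On the real axis, `𝓡` is nonnegative. -/
theorem jetR_ofReal (c : Fin 3 → ℝ) (l : ℝ) (j : ℂ × ℂ × ℂ) :
    jetR c l j = ((‖jet11 c l j‖ ^ 2 + ‖jet12 c l j‖ ^ 2 : ℝ) : ℂ) := by
  have hl : star (l : ℂ) = l := Complex.conj_ofReal l
  have h1 := jet11_star c l j
  have h2 := jet21_star c l j
  rw [hl] at h1 h2
  push_cast
  rw [norm_sq_eq_mul_star, norm_sq_eq_mul_star, jetR, h2]
  linear_combination (-jet11 c l j) * h1

/-! ### Reality of the spectral curve -/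

/-- A simple root of `𝓡` is not real. -/
theorem im_ne_zero_of_root {c : Fin 3 → ℝ} {lam : Fin 6 → ℂ} (hns : Function.Injective lam)
    {j : ℂ × ℂ × ℂ} (hR : ∀ l, jetR c l j = ∏ i, (l - lam i)) (i : Fin 6) :
    (lam i).im ≠ 0 := by
  intro him
  obtain ⟨a, ha⟩ : ∃ a : ℝ, lam i = a := ⟨(lam i).re, Complex.ext rfl (by simpa using him)⟩
  have h0 : jetR c (lam i) j = 0 := by
    rw [hR]
    exact Finset.prod_eq_zero (Finset.mem_univ i) (sub_self _)
  have h0' := h0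
  rw [ha, jetR_ofReal] at h0'
  have hsum : ‖jet11 c a j‖ ^ 2 + ‖jet12 c a j‖ ^ 2 = 0 := by exact_mod_cast h0'
  have h11 : jet11 c a j = 0 := by
    have : ‖jet11 c a j‖ ^ 2 = 0 := by nlinarith [sq_nonneg ‖jet11 c a j‖, sq_nonneg ‖jet12 c a j‖]
    simpa using this
  have h12 : jet12 c a j = 0 := by
    have : ‖jet12 c a j‖ ^ 2 = 0 := by nlinarith [sq_nonneg ‖jet11 c a j‖, sq_nonneg ‖jet12 c a j‖]
    simpa using this
  have h21 : jet21 c a j = 0 := by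
    have h := jet21_star c a j
    rw [show star (a : ℂ) = a from Complex.conj_ofReal a, h12] at h
    simpa using h
  have d11 : DifferentiableAt ℂ (fun l => jet11 c l j) a := by unfold jet11; fun_prop
  have d12 : DifferentiableAt ℂ (fun l => jet12 c l j) a := by unfold jet12; fun_prop
  have d21 : DifferentiableAt ℂ (fun l => jet21 c l j) a := by unfold jet21; fun_prop
  -- 𝓡 is quadratic in entries that all vanish at this point, so its derivative vanishes too; at a
  -- simple root the derivative is a non-zero product of differences.
  have hd : HasDerivAt (fun l => jetR c l j) 0 (a : ℂ) := by
    convert! ((d11.hasDerivAt.pow 2).neg).sub (d12.hasDerivAt.mul d21.hasDerivAt) using 1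
    simp [h11, h12, h21]
  have hprod : (fun l => jetR c l j)
      = fun l => (l - lam i) * ∏ k ∈ Finset.univ.erase i, (l - lam k) := by
    funext l
    rw [hR, Finset.mul_prod_erase Finset.univ (fun k => l - lam k) (Finset.mem_univ i)]
  have dQ : DifferentiableAt ℂ (fun l => ∏ k ∈ Finset.univ.erase i, (l - lam k)) a := by fun_prop
  have hd' : HasDerivAt (fun l => jetR c l j) (∏ k ∈ Finset.univ.erase i, (lam i - lam k))
      (a : ℂ) := by
    rw [hprod]
    convert! ((hasDerivAt_id (a : ℂ)).sub_const (lam i)).mul dQ.hasDerivAt using 1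
    simp [ha]
  have hne : ∏ k ∈ Finset.univ.erase i, (lam i - lam k) ≠ 0 :=
    Finset.prod_ne_zero_iff.2 fun k hk => sub_ne_zero.2 fun h =>
      Finset.ne_of_mem_erase hk (hns h).symm
  exact hne (hd'.unique hd)

/-- The branch points form three complex-conjugate pairs. -/
theorem exists_areConjugatePairs {c : Fin 3 → ℝ} {lam : Fin 6 → ℂ}
    (hns : Function.Injective lam) {j : ℂ × ℂ × ℂ}
    (hR : ∀ l, jetR c l j = ∏ i, (l - lam i)) :
    ∃ r s : Fin 3 → ℝ, AreConjugatePairs lam r s := by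
  have him := im_ne_zero_of_root hns hR
  have hconj : ∀ i, ∃ k, lam k = star (lam i) := fun i => by
    have h0 : ∏ k, (star (lam i) - lam k) = 0 := by
      rw [← hR, jetR_star, hR, Finset.prod_eq_zero (Finset.mem_univ i) (sub_self _), star_zero]
    obtain ⟨k, -, hk⟩ := Finset.prod_eq_zero_iff.1 h0
    exact ⟨k, (sub_eq_zero.1 hk).symm⟩
  choose τ hτ using hconj
  have hττ : ∀ i, τ (τ i) = i := fun i => hns (by rw [hτ, hτ, star_star])
  have hτim : ∀ i, (lam (τ i)).im = -(lam i).im := fun i => by rw [hτ]; simp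
  -- Conjugation exchanges the roots in the upper half-plane with the remaining ones, so there are
  -- three of each.
  let U : Finset (Fin 6) := Finset.univ.filter fun i => 0 < (lam i).im
  have hUV : U.image τ = Finset.univ.filter fun i => ¬ 0 < (lam i).im := by
    ext i
    simp only [U, Finset.mem_image, Finset.mem_filter, Finset.mem_univ, true_and]
    constructor
    · rintro ⟨k, hk, rfl⟩
      rw [hτim]; linarith
    · intro hi
      refine ⟨τ i, ?_, hττ i⟩
      rw [hτim]
      have := lt_of_le_of_ne (not_lt.1 hi) (him i)
      linarith
  have hcard : U.card = 3 := by
    have h1 : (U.image τ).card = U.card :=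
      Finset.card_image_of_injective U (Function.LeftInverse.injective hττ)
    have h2 := Finset.card_filter_add_card_filter_not (s := (Finset.univ : Finset (Fin 6)))
      (fun i => 0 < (lam i).im)
    rw [← hUV, h1] at h2
    have h3 : U.card + U.card = 6 := by simpa using h2
    omega
  let e : Fin 3 ≃ U := (Finset.equivFinOfCardEq hcard).symm
  -- Sorting by imaginary part provides the numbering s₀ ≤ s₁ ≤ s₂.
  let σ := Tuple.sort fun k => (lam (e k)).im
  have hmono := Tuple.monotone_sort fun k => (lam (e k)).im
  let f : Fin 3 → Fin 6 := fun k => e (σ k)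
  have hf : ∀ k, 0 < (lam (f k)).im := fun k => (Finset.mem_filter.1 (e (σ k)).2).2
  have hfsurj : ∀ i, 0 < (lam i).im → ∃ k, f k = i := fun i hi => by
    obtain ⟨k, hk⟩ := e.surjective ⟨i, Finset.mem_filter.2 ⟨Finset.mem_univ i, hi⟩⟩
    refine ⟨σ.symm k, ?_⟩
    simp only [f, Equiv.apply_symm_apply, hk]
  let g : Fin 6 → Fin 6 := ![f 0, τ (f 0), f 1, τ (f 1), f 2, τ (f 2)]
  have hg : ∀ k : Fin 3, (∃ a, g a = f k) ∧ ∃ a, g a = τ (f k) := fun k => by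
    fin_cases k
    · exact ⟨⟨0, rfl⟩, ⟨1, rfl⟩⟩
    · exact ⟨⟨2, rfl⟩, ⟨3, rfl⟩⟩
    · exact ⟨⟨4, rfl⟩, ⟨5, rfl⟩⟩
  have hgsurj : Function.Surjective g := fun i => by
    rcases lt_or_gt_of_ne (him i) with hi | hi
    · obtain ⟨k, hk⟩ := hfsurj (τ i) (by rw [hτim]; linarith)
      obtain ⟨a, ha⟩ := (hg k).2
      exact ⟨a, by rw [ha, hk, hττ]⟩
    · obtain ⟨k, hk⟩ := hfsurj i hi
      obtain ⟨a, ha⟩ := (hg k).1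
      exact ⟨a, by rw [ha, hk]⟩
  have hval : ∀ k, lam (f k) = ((lam (f k)).re : ℂ) + Complex.I * ((lam (f k)).im : ℂ) :=
    fun k => by rw [mul_comm, Complex.re_add_im]
  have hvalτ : ∀ k, lam (τ (f k)) = ((lam (f k)).re : ℂ) - Complex.I * ((lam (f k)).im : ℂ) :=
    fun k => by
      rw [hτ]
      apply Complex.ext <;> simp
  exact ⟨fun k => (lam (f k)).re, fun k => (lam (f k)).im, hf 0, hmono (by decide),
    hmono (by decide), Equiv.ofBijective g (Finite.surjective_iff_bijective.1 hgsurj),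
    hval 0, hvalτ 0, hval 1, hvalτ 1, hval 2, hvalτ 2⟩

/-! ### Bounds of the solution -/

namespace IsSmoothTwoPhaseSolution

variable {p : ℝ → ℝ → ℂ} {c : Fin 3 → ℝ}

/-- The jet of a bounded two-phase solution is bounded. -/
theorem exists_jet_bound (hp : IsSmoothTwoPhaseSolution p c) (hbdd : IsBoundedSolution p)
    {lam : Fin 6 → ℂ} (hlam : IsBranchPoints p c lam) : ∃ K : ℝ, ∀ x t, ‖jet p x t‖ ≤ K := by
  obtain ⟨B, hB⟩ := hbdd
  -- For real l, |Ψ₁₂|² ≤ 𝓡(l), which is the same at all (x, t). Bounds at l = 1, -1, 0 together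
  -- with the bound on p control p' and p'', which `G` recovers.
  have h12 : ∀ l : ℝ, ∃ K : ℝ, ∀ x t, ‖jet12 c l (jet p x t)‖ ≤ K := fun l => by
    refine ⟨√‖∏ i, ((l : ℂ) - lam i)‖, fun x t => Real.le_sqrt_of_sq_le ?_⟩
    rw [← hp.jetR_eq hlam l x t, jetR_ofReal, Complex.norm_real]
    exact le_trans (by nlinarith [sq_nonneg ‖jet11 c l (jet p x t)‖]) (Real.le_norm_self _)
  obtain ⟨K₁, h₁⟩ := h12 1
  obtain ⟨K₂, h₂⟩ := h12 (-1)
  obtain ⟨K₃, h₃⟩ := h12 0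
  let b : ℂ × ℂ × ℂ × ℂ → ℂ := fun q => -(q.2.1 - q.2.2.1) + 2 * Complex.I * c 2 * q.1
  let G : ℂ × ℂ × ℂ × ℂ → ℂ × ℂ × ℂ := fun q => (q.1, b q,
    4 * Complex.I * (q.2.2.2 + 1 / 2 * Complex.I * q.1 * (‖q.1‖ : ℂ) ^ 2 + 1 / 2 * c 2 * b q
      - Complex.I * c 1 * q.1))
  have hG : Continuous G := by fun_prop
  let Z := Metric.closedBall (0 : ℂ) B ×ˢ Metric.closedBall (0 : ℂ) K₁ ×ˢ
    Metric.closedBall (0 : ℂ) K₂ ×ˢ Metric.closedBall (0 : ℂ) K₃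
  have hZ : IsCompact Z := (isCompact_closedBall _ _).prod ((isCompact_closedBall _ _).prod
    ((isCompact_closedBall _ _).prod (isCompact_closedBall _ _)))
  obtain ⟨K, hK⟩ := hZ.exists_bound_of_continuousOn hG.continuousOn
  refine ⟨K, fun x t => ?_⟩
  have hjet : jet p x t = G (p x t, jet12 c (1 : ℝ) (jet p x t), jet12 c (-1 : ℝ) (jet p x t),
      jet12 c (0 : ℝ) (jet p x t)) := by
    refine Prod.ext rfl (Prod.ext ?_ ?_)
    · simp [G, b, jet12, jet]
      ring
    · simp [G, b, jet12, jet]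
      linear_combination dx (dx p) x t * Complex.I_sq
  rw [hjet]
  apply hK
  exact ⟨by simpa using hB x t, by simpa using h₁ x t, by simpa using h₂ x t,
    by simpa using h₃ x t⟩

/-- At a local extremum of `|p|²` with a non-zero value, `(ν₁, ν₂)` comes from an arrangement of the
branch points. -/
theorem corresponds_of_isLocalExtr (hp : IsSmoothTwoPhaseSolution p c) {lam : Fin 6 → ℂ}
    (hlam : IsBranchPoints p c lam) (hns : Function.Injective lam) {x t : ℝ}
    (hext : IsLocalExtr (fun q : ℝ × ℝ => nu1 p q.1 q.2) (x, t)) (h0 : nu1 p x t ≠ 0) :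
    ∃ y : ℝ, nu2 p x t = y ∧ Corresponds lam (nu1 p x t : ℂ) (y : ℂ) := by
  have hx : IsLocalExtr (fun y => nu1 p y t) x :=
    IsExtrFilter.comp_tendsto (g := fun y : ℝ => (y, t)) hext
      ((Continuous.prodMk continuous_id continuous_const).tendsto x)
  have ht : IsLocalExtr (fun u => nu1 p x u) t :=
    IsExtrFilter.comp_tendsto (g := fun u : ℝ => (x, u)) hext
      ((Continuous.prodMk continuous_const continuous_id).tendsto t)
  obtain ⟨h1, h2⟩ := jetG_eq_zero_iff _ (hx.hasDerivAt_eq_zero (hp.hasDerivAt_nu1_x x t))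
    (ht.hasDerivAt_eq_zero (hp.hasDerivAt_nu1_t x t))
  have hp0 : (jet p x t).1 ≠ 0 := fun h => h0 (by rw [nu1, show p x t = 0 from h]; simp)
  refine ⟨_, nu2_jet_real (jet p x t), ?_⟩
  rw [← nu2_jet_real, nu1, Complex.ofReal_pow]
  exact corresponds_of_jet hns (fun l => hp.jetR_eq hlam l x t) hp0 h1 h2

/-- A non-zero supremum or infimum of `|p|²` comes from an arrangement of the branch points. -/
theorem corresponds_of_isLUB_or_isGLB (hp : IsSmoothTwoPhaseSolution p c)
    (hbdd : IsBoundedSolution p) {lam : Fin 6 → ℂ} (hlam : IsBranchPoints p c lam)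
    (hns : Function.Injective lam) {M : ℝ}
    (hM : IsLUB (Set.range (fun q : ℝ × ℝ => nu1 p q.1 q.2)) M ∨
      IsGLB (Set.range (fun q : ℝ × ℝ => nu1 p q.1 q.2)) M) (h0 : M ≠ 0) :
    ∃ y : ℝ, Corresponds lam (M : ℂ) (y : ℂ) := by
  obtain ⟨K, hK⟩ := hp.exists_jet_bound hbdd hlam
  have hball : IsCompact (Metric.closedBall (0 : ℂ × ℂ × ℂ) K) := isCompact_closedBall _ _
  have hmem : ∀ x t, jet p x t ∈ Metric.closedBall (0 : ℂ × ℂ × ℂ) K := fun x t => by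
    simpa using hK x t
  obtain ⟨Fx, hFx, hdx⟩ := hp.exists_hasDerivAt_jetGx
  obtain ⟨Ft, hFt, hdt⟩ := hp.exists_hasDerivAt_jetGt
  obtain ⟨Cx, hCx⟩ := hball.exists_bound_of_continuousOn hFx.continuousOn
  obtain ⟨Ct, hCt⟩ := hball.exists_bound_of_continuousOn hFt.continuousOn
  obtain ⟨C, hC, hCxC, hCtC⟩ : ∃ C : ℝ, 0 < C ∧ Cx ≤ C ∧ Ct ≤ C :=
    ⟨max 1 (max Cx Ct), lt_max_of_lt_left one_pos, by simp, by simp⟩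
  have hside : (∀ x t, nu1 p x t ≤ M) ∨ ∀ x t, M ≤ nu1 p x t :=
    hM.imp (fun h x t => h.1 ⟨(x, t), rfl⟩) fun h x t => h.1 ⟨(x, t), rfl⟩
  have hgx : ∀ x t, jetGx (jet p x t) ^ 2 ≤ 4 * C * |M - ‖(jet p x t).1‖ ^ 2| := fun x t =>
    sq_deriv_le_of_bound_abs hC (fun y => hp.hasDerivAt_nu1_x y t) (fun y => hdx y t)
      (fun y => (hCx _ (hmem y t)).trans hCxC)
      (hside.imp (fun h y => h y t) fun h y => h y t) x
  have hgt : ∀ x t, jetGt (jet p x t) ^ 2 ≤ 4 * C * |M - ‖(jet p x t).1‖ ^ 2| := fun x t =>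
    sq_deriv_le_of_bound_abs hC (fun u => hp.hasDerivAt_nu1_t x u) (fun u => hdt x u)
      (fun u => (hCt _ (hmem x u)).trans hCtC)
      (hside.imp (fun h u => h x u) fun h u => h x u) t
  -- A compact set containing all jets of p. It is cut out by closed conditions that force both
  -- derivatives of |p|² to vanish wherever |p|² = M.
  let Z : Set (ℂ × ℂ × ℂ) := Metric.closedBall 0 K ∩
    ({j | ∀ l, jetR c l j = ∏ i, (l - lam i)} ∩
      ({j | jetGx j ^ 2 ≤ 4 * C * |M - ‖j.1‖ ^ 2|} ∩ {j | jetGt j ^ 2 ≤ 4 * C * |M - ‖j.1‖ ^ 2|}))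
  have hZ : IsCompact Z := by
    refine hball.inter_right (IsClosed.inter ?_ (IsClosed.inter ?_ ?_))
    · rw [Set.ofPred_forall]
      exact isClosed_iInter fun l => isClosed_eq (continuous_jetR c l) continuous_const
    · exact isClosed_le (continuous_jetGx.pow 2) (by fun_prop)
    · exact isClosed_le (continuous_jetGt.pow 2) (by fun_prop)
  have himage : IsClosed ((fun j : ℂ × ℂ × ℂ => ‖j.1‖ ^ 2) '' Z) :=
    (hZ.image (by fun_prop)).isClosed
  have hsub : Set.range (fun q : ℝ × ℝ => nu1 p q.1 q.2) ⊆
      (fun j : ℂ × ℂ × ℂ => ‖j.1‖ ^ 2) '' Z := by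
    rintro _ ⟨⟨x, t⟩, rfl⟩
    exact ⟨jet p x t, ⟨hmem x t, fun l => hp.jetR_eq hlam l x t, hgx x t, hgt x t⟩, rfl⟩
  have hne : (Set.range (fun q : ℝ × ℝ => nu1 p q.1 q.2)).Nonempty := Set.range_nonempty _
  have hclos : M ∈ closure (Set.range (fun q : ℝ × ℝ => nu1 p q.1 q.2)) :=
    hM.elim (fun h => h.mem_closure hne) fun h => h.mem_closure hne
  -- This jet realizes M but need not be a jet of p at any point; only its algebraic relations are
  -- used.
  obtain ⟨j, ⟨-, hR, hx, ht⟩, hj⟩ := closure_minimal hsub himage hclos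
  have hj' : ‖j.1‖ ^ 2 = M := hj
  simp only [Set.mem_ofPred_eq, hj', sub_self, abs_zero, mul_zero] at hx ht
  obtain ⟨h1, h2⟩ := jetG_eq_zero_iff j (pow_eq_zero_iff two_ne_zero |>.1
    (le_antisymm hx (sq_nonneg _))) (pow_eq_zero_iff two_ne_zero |>.1
    (le_antisymm ht (sq_nonneg _)))
  have hj0 : j.1 ≠ 0 := fun h => h0 (by rw [← hj', h]; simp)
  refine ⟨-2 * (star j.1 * j.2.1).im, ?_⟩
  rw [← nu2_jet_real, ← hj', Complex.ofReal_pow]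
  exact corresponds_of_jet hns hR hj0 h1 h2

end IsSmoothTwoPhaseSolution

end

theorem theorem6 (p : ℝ → ℝ → ℂ) (c : Fin 3 → ℝ) (lam : Fin 6 → ℂ)
    (hp : IsSmoothTwoPhaseSolution p c) (hbdd : IsBoundedSolution p)
    (hlam : IsBranchPoints p c lam) (hns : Function.Injective lam) :
    -- the branch points form three complex-conjugate pairs
    (∃ r s : Fin 3 → ℝ, AreConjugatePairs lam r s) ∧
    -- the polynomial `P` has degree ten
    (polyP lam).natDegree = 10 ∧
    ∀ r s : Fin 3 → ℝ, AreConjugatePairs lam r s →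
      -- there are exactly four distinct real pairs of a root of `P` and a corresponding `ν₂`
      ({q : ℝ × ℝ | (polyP lam).IsRoot (q.1 : ℂ) ∧ Corresponds lam (q.1 : ℂ) (q.2 : ℂ)}
          = Set.range (fun i : Fin 4 => (nu1Root s i, nu2Root r s i)) ∧
        Function.Injective (fun i : Fin 4 => (nu1Root s i, nu2Root r s i))) ∧
      -- the order of the four values of `ν₁`
      (0 ≤ nu1Root s 0 ∧ nu1Root s 0 ≤ nu1Root s 1 ∧ nu1Root s 1 ≤ nu1Root s 2 ∧
        nu1Root s 2 < nu1Root s 3 ∧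
        (s 1 < s 2 → nu1Root s 0 < nu1Root s 1) ∧ (s 0 < s 1 → nu1Root s 1 < nu1Root s 2)) ∧
      -- for distinct real parts, `P` has no other real roots, and every corresponding `ν₂` is real
      (Function.Injective r →
        (∀ x : ℝ, (polyP lam).IsRoot (x : ℂ) ↔ x ∈ Set.range (nu1Root s)) ∧
        ∀ (x : ℝ) (z : ℂ), Corresponds lam (x : ℂ) z → ∃ y : ℝ, z = (y : ℂ)) ∧
      -- the four values are the only possible non-zero bounds of the solution
      (∀ x t : ℝ, IsLocalExtr (fun q : ℝ × ℝ => nu1 p q.1 q.2) (x, t) → nu1 p x t ≠ 0 →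
        ∃ i : Fin 4, nu1 p x t = nu1Root s i ∧ nu2 p x t = (nu2Root r s i : ℂ)) ∧
      (∀ M : ℝ, (IsLUB (Set.range (fun q : ℝ × ℝ => nu1 p q.1 q.2)) M ∨
          IsGLB (Set.range (fun q : ℝ × ℝ => nu1 p q.1 q.2)) M) → M ≠ 0 →
        M ∈ Set.range (nu1Root s)) := by 
  obtain ⟨x₀, t₀, -⟩ := id hlam
  refine ⟨exists_areConjugatePairs hns (fun l => hp.jetR_eq hlam l x₀ t₀), natDegree_polyP lam,
    fun r s h => ⟨⟨setOf_real_pairs_eq_range hns h, injective_nuRoot hns h⟩,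
      nu1Root_order h.1 h.2.1 h.2.2.1, fun hr => ⟨isRoot_real_iff_of_injective hns h hr, ?_⟩,
      ?_, ?_⟩⟩
  · intro x z hc
    obtain ⟨i, -, hz⟩ := exists_nuRoot_of_corresponds_of_injective h hr hc
    exact ⟨_, hz⟩
  · intro x t hext h0
    obtain ⟨y, hy, hc⟩ := hp.corresponds_of_isLocalExtr hlam hns hext h0
    obtain ⟨i, hx, hy'⟩ := exists_nuRoot_of_corresponds_real hns h hc
    exact ⟨i, hx, by rw [hy, hy']⟩
  · intro M hM h0
    obtain ⟨y, hc⟩ := hp.corresponds_of_isLUB_or_isGLB hbdd hlam hns hM h0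
    obtain ⟨i, hx, -⟩ := exists_nuRoot_of_corresponds_real hns h hc
    exact ⟨i, hx.symm⟩
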